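/- Let $\omega^{<\omega}$ be the set of finite sequences of natural numbers. For a function $g:\omega^{<\omega}\to\omega$ let $A_g=\{f\in\omega^\omega : f(n)<g(f\restriction n)\text{ for infinitely many }n\in\omega\}$, and let $I_L$ be the $\sigma$-ideal on $\omega^\omega$ generated by the sets $A_g$; a subset of $\omega^\omega$ is $I_L$-positive if it does not belong to $I_L$. A Laver tree is a set $T\subset\omega^{<\omega}$, closed under initial segments, that has a node $s\in T$ (the trunk) such that every $t\in T$ is comparable with $s$ and every $t\in T$ extending $s$ has infinitely many immediate successors $t^\frown\langle k\rangle\in T$; $[T]=\{f\in\omega^\omega:\forall n\ f\restriction n\in T\}$ is the set of its branches. (1) For every $I_L$-positive Borel set $A\subset\omega^\omega$ there is a Laver tree $T$ with $[T]\subset A$. (2) (ZF+AD) For every $I_L$-positive set $A\subset\omega^\omega$ there is a Laver tree $T$ with $[T]\subset A$. That is, this sentence holds in every model of ZF together with the axiom of determinacy AD (every game of length $\omega$ on the natural numbers, with any payoff set $A\subset\omega^\omega$, is determined). -/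

import Mathlib

/-! ### The ideal and Laver trees on Baire space `ℕ → ℕ` -/

namespace Laver

/-- The restriction `f ↾ n`, the finite sequence of the first `n` values of `f`. -/
def initSeg (f : ℕ → ℕ) (n : ℕ) : List ℕ := (List.range n).map f

/-- `A_g`: the set of all `f` such that `f(n) < g(f ↾ n)` for infinitely many `n`. -/
def smallSet (g : List ℕ → ℕ) : Set (ℕ → ℕ) :=
  {f | {n : ℕ | f n < g (initSeg f n)}.Infinite}

/-- A σ-ideal on a set `X`: a family of subsets that contains the empty set and is closed under
subsets and countable unions. -/
structure IsSigmaIdeal {X : Type*} (J : Set (Set X)) : Prop where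
  empty_mem : ∅ ∈ J
  subset_mem : ∀ A ∈ J, ∀ B, B ⊆ A → B ∈ J
  iUnion_mem : ∀ F : ℕ → Set X, (∀ n, F n ∈ J) → (⋃ n, F n) ∈ J

/-- `I_L`: the σ-ideal generated by the sets `A_g`, i.e. the least σ-ideal containing them. -/
def laverIdeal : Set (Set (ℕ → ℕ)) :=
  {A | ∀ J : Set (Set (ℕ → ℕ)), IsSigmaIdeal J → (∀ g, smallSet g ∈ J) → A ∈ J}

/-- `T` is a Laver tree: it has a node `s` (the trunk) such that every node is comparable with `s`
and every node extending `s` has infinitely many immediate successors in `T`. -/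
def IsLaverTree (T : Descriptive.tree ℕ) : Prop :=
  ∃ s ∈ T, (∀ t ∈ T, t <+: s ∨ s <+: t) ∧ ∀ t ∈ T, s <+: t → {k : ℕ | t ++ [k] ∈ T}.Infinite

/-- `[T]`: the set of all branches of `T`. -/
def branches (T : Descriptive.tree ℕ) : Set (ℕ → ℕ) := {f | ∀ n, initSeg f n ∈ T}

end Laver

/-! ### Models of ZF

A structure for the language of set theory is a type `M` with a binary relation, given as
`Membership M M`; here `x ∈ a` for `x a : M` is the membership relation of the structure. Neither
transitivity nor well-foundedness is assumed. -/

namespace SetModel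

/-- The only non-logical symbol of the language of set theory: a binary relation. -/
inductive SetRel : ℕ → Type
  | mem : SetRel 2

/-- The first-order language of set theory. -/
def setLang : FirstOrder.Language.{0, 0} := ⟨fun _ => Empty, SetRel⟩

instance setStructure (M : Type*) [Membership M M] : setLang.Structure M where
  funMap := fun f _ => Empty.elim f
  RelMap := fun r => match r with
    | SetRel.mem => fun v => v 0 ∈ v 1

section

variable {M : Type*} [Membership M M]

/-- `e = ∅`. -/
def IsEmpty (e : M) : Prop := ∀ x : M, x ∉ e

/-- `a ⊆ b`. -/
def Sub (a b : M) : Prop := ∀ x ∈ a, x ∈ b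

/-- `y = x ∪ {x}`. -/
def IsSucc (y x : M) : Prop := ∀ z : M, z ∈ y ↔ z ∈ x ∨ z = x

/-- `p = {a, b}`. -/
def IsUPair (p a b : M) : Prop := ∀ z : M, z ∈ p ↔ z = a ∨ z = b

/-- `p = (a, b) = {{a}, {a, b}}`. -/
def IsPair (p a b : M) : Prop := ∃ s d : M, IsUPair s a a ∧ IsUPair d a b ∧ IsUPair p s d

/-- `w` contains `∅` and is closed under `x ↦ x ∪ {x}`. -/
def IsInductive (w : M) : Prop :=
  (∃ e ∈ w, IsEmpty e) ∧ ∀ x ∈ w, ∃ y ∈ w, IsSucc y x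

end

/-- `M` is a model of ZF. The two schemes range over all classes, respectively binary relations,
that are first-order definable over `M` with parameters from `M`. -/
structure IsModelZF (M : Type*) [Membership M M] : Prop where
  extensionality : ∀ a b : M, (∀ x : M, x ∈ a ↔ x ∈ b) → a = b
  foundation : ∀ a : M, (∃ x : M, x ∈ a) → ∃ x ∈ a, ∀ y ∈ x, y ∉ a
  pairing : ∀ a b : M, ∃ p : M, IsUPair p a b
  union : ∀ a : M, ∃ u : M, ∀ x : M, x ∈ u ↔ ∃ y ∈ a, x ∈ y
  powerset : ∀ a : M, ∃ p : M, ∀ x : M, x ∈ p ↔ Sub x a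
  infinity : ∃ w : M, IsInductive w
  separation : ∀ S : Set M, (Set.univ : Set M).Definable₁ setLang S →
    ∀ a : M, ∃ b : M, ∀ x : M, x ∈ b ↔ x ∈ a ∧ x ∈ S
  replacement : ∀ R : Set (M × M), (Set.univ : Set M).Definable₂ setLang R →
    ∀ a : M, (∀ x ∈ a, ∀ y z : M, (x, y) ∈ R → (x, z) ∈ R → y = z) →
      ∃ b : M, ∀ y : M, y ∈ b ↔ ∃ x ∈ a, (x, y) ∈ R

/-! ### The same notions, and the axiom of determinacy, inside a structure `M`

All quantifiers range over `M`. The parameter `w` is the set `ω` of `M`. -/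

section

variable {M : Type*} [Membership M M]

/-- `w = ω`: the least inductive set. -/
def IsOmega (w : M) : Prop := IsInductive w ∧ ∀ v : M, IsInductive v → Sub w v

/-- `(x, y) ∈ f`; for a function `f` this says `f(x) = y`. -/
def Val (f x y : M) : Prop := ∃ p ∈ f, IsPair p x y

/-- `f` is a function from `a` to `b`. -/
def IsFun (f a b : M) : Prop :=
  (∀ p ∈ f, ∃ x ∈ a, ∃ y ∈ b, IsPair p x y) ∧ ∀ x ∈ a, ∃! y : M, Val f x y

/-- `r = f ↾ a`. -/
def IsRestr (r f a : M) : Prop := ∀ p : M, p ∈ r ↔ p ∈ f ∧ ∃ x ∈ a, ∃ y : M, IsPair p x y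

/-- `s ∈ ω^{<ω}`. -/
def IsFinSeq (w s : M) : Prop := ∃ n ∈ w, IsFun s n w

/-- `t` is the one-step extension `s ⌢ ⟨k⟩` of the finite sequence `s`. -/
def IsSnoc (w t s k : M) : Prop :=
  ∃ n ∈ w, IsFun s n w ∧ ∀ p : M, p ∈ t ↔ p ∈ s ∨ IsPair p n k

/-- `f ∈ ω^ω`. -/
def IsReal (w f : M) : Prop := IsFun f w w

/-- `A ⊆ ω^ω`. -/
def IsSetOfReals (w A : M) : Prop := ∀ f ∈ A, IsReal w f

/-- `g` is a function from `ω^{<ω}` to `ω`. -/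
def IsSeqFun (w g : M) : Prop :=
  (∀ p ∈ g, ∃ s k : M, IsFinSeq w s ∧ k ∈ w ∧ IsPair p s k) ∧
    ∀ s : M, IsFinSeq w s → ∃! k : M, Val g s k

/-- `e` is the set of even natural numbers. -/
def IsEvens (w e : M) : Prop :=
  Sub e w ∧ (∀ z : M, IsEmpty z → z ∈ e) ∧ ∀ n ∈ w, ∀ m : M, IsSucc m n → (m ∈ e ↔ n ∉ e)

/-- `x(n) = σ(x ↾ n)`: the `n`-th move of the run `x` is the one prescribed by `σ`. -/
def Obeys (σ x n : M) : Prop := ∃ s k : M, IsRestr s x n ∧ Val x n k ∧ Val σ s k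

/-- The game on `ω` with payoff set `A ⊆ ω^ω` is determined. The players produce `x ∈ ω^ω`, player I
choosing `x(n)` for even `n` and player II for odd `n`; player I wins if and only if `x ∈ A`. -/
def IsDetermined (w e A : M) : Prop :=
  (∃ σ : M, IsSeqFun w σ ∧
    ∀ x : M, IsReal w x → (∀ n ∈ w, n ∈ e → Obeys σ x n) → x ∈ A) ∨
  (∃ τ : M, IsSeqFun w τ ∧
    ∀ x : M, IsReal w x → (∀ n ∈ w, n ∉ e → Obeys τ x n) → x ∉ A)

/-- `X = A_g`: the set of all `f ∈ ω^ω` such that `f(n) ∈ g(f ↾ n)` for infinitely many `n ∈ ω`. -/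
def IsSmallSet (w g X : M) : Prop :=
  ∀ f : M, f ∈ X ↔ IsReal w f ∧ ∀ m ∈ w, ∃ n ∈ w, m ∈ n ∧
    ∃ s k l : M, IsRestr s f n ∧ Val f n k ∧ Val g s l ∧ k ∈ l

/-- `J` is a σ-ideal on `ω^ω`. -/
structure IsSigmaIdeal (w J : M) : Prop where
  isSetOfReals : ∀ X ∈ J, IsSetOfReals w X
  empty_mem : ∀ z : M, IsEmpty z → z ∈ J
  subset_mem : ∀ X ∈ J, ∀ Y : M, Sub Y X → Y ∈ J
  iUnion_mem : ∀ F : M, IsFun F w J →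
    ∀ U : M, (∀ x : M, x ∈ U ↔ ∃ n ∈ w, ∃ X : M, Val F n X ∧ x ∈ X) → U ∈ J

/-- `A ∈ I_L`: the set `A` belongs to every σ-ideal on `ω^ω` that contains all the sets `A_g`,
`g : ω^{<ω} → ω`. -/
def InLaverIdeal (w A : M) : Prop :=
  ∀ J : M, IsSigmaIdeal w J →
    (∀ g : M, IsSeqFun w g → ∀ X : M, IsSmallSet w g X → X ∈ J) → A ∈ J

/-- `T` is a Laver tree: a set of finite sequences of natural numbers that is closed under initial
segments and has a node `s` (the trunk) such that every node is comparable with `s` and every node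
extending `s` has infinitely many immediate successors in `T`. -/
structure IsLaverTree (w T : M) : Prop where
  isFinSeq : ∀ t ∈ T, IsFinSeq w t
  restr_mem : ∀ t ∈ T, ∀ n ∈ w, ∀ s : M, IsRestr s t n → s ∈ T
  trunk : ∃ s ∈ T, (∀ t ∈ T, Sub t s ∨ Sub s t) ∧
    ∀ t ∈ T, Sub s t → ∀ m ∈ w, ∃ k ∈ w, m ∈ k ∧ ∃ u ∈ T, IsSnoc w u t k

/-- `f ∈ [T]`: `f` is a branch of the tree `T`. -/
def IsBranch (w T f : M) : Prop :=
  IsReal w f ∧ ∀ n ∈ w, ∀ s : M, IsRestr s f n → s ∈ T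

end

/-- `M` satisfies AD: every game on `ω` with payoff set `A ⊆ ω^ω` is determined. -/
def SatisfiesAD (M : Type*) [Membership M M] : Prop :=
  ∀ w e : M, IsOmega w → IsEvens w e → ∀ A : M, IsSetOfReals w A → IsDetermined w e A

end SetModel

/-! ### Initial segments and large nodes -/

namespace Laver

/-! Both halves show that a set contained in no single `A_g` contains the branches of a Laver tree;
positivity is used for little else.

Borel case. A Borel set is analytic, so let `A` be the range of a continuous `φ`. Call `B` large at
`s` if no `g` defeats all its members through `s` from `s` on. A positive set is large somewhere
(`exists_largeAt`), and largeness passes to infinitely many successors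
(`LargeAt.infinite_children`). If a countable union is large at `s`, then an infinitely branching
well-founded tree leads from `s` to nodes where one of the pieces is large
(`LargeAt.reaches_iUnion`). Apply this to the pieces `imageThrough φ (u ++ [i])`: carry along the
nodes a label `(u, α)`, a finite part of a `φ`-preimage and the rank left until it can be extended.
At rank-lowering steps `u` waits; elsewhere it grows (`infinite_reaches_successors`). Ordinals do
not descend forever, so along every branch `x` the parts `u` build a `y`, and `φ y = x` by
continuity.

Determinacy case. In the Laver game for `A`, player I declares a trunk length `N` and then plays the
values of some `x`, while II plays a bound before each value. Player I wins iff `x` is in `A` and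
respects the bounds from `N` on. If II wins, the maximum of II's bounds over all `N` up to the
length of `s` is a natural number `g(s)`, and `A` is contained in `A_g` (`exists_bound_of_winning`).
If I wins by `σ`, the sequences that `σ` can be led to play form a Laver tree
(`isLaverTree_leadTree`). Choice is not available in `M`, so II leads `σ` by least moves: each node
then determines its position in the game, and the positions along a branch cohere into one run
(`mem_of_isBranch_leadTree`).

The model may be ill-founded with a nonstandard `ω`. All recursion and induction therefore take
place inside `M`, for definable predicates only; the classes `Dfn` and `DFun` supply definability.
-/

theorem length_initSeg (f : ℕ → ℕ) (n : ℕ) : (initSeg f n).length = n := by simp [initSeg]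

theorem initSeg_succ (f : ℕ → ℕ) (n : ℕ) : initSeg f (n + 1) = initSeg f n ++ [f n] := by
  simp [initSeg, List.range_succ]

theorem take_initSeg (f : ℕ → ℕ) {m n : ℕ} (h : m ≤ n) :
    (initSeg f n).take m = initSeg f m := by
  simp [initSeg, ← List.map_take, List.take_range, h]

theorem getElem_initSeg (f : ℕ → ℕ) {m n : ℕ} (h : m < (initSeg f n).length) :
    (initSeg f n)[m] = f m := by simp [initSeg]

theorem initSeg_eq_of_prefix {f : ℕ → ℕ} {s : List ℕ} {n : ℕ} (h : s <+: initSeg f n) :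
    initSeg f s.length = s := by
  have hl := h.length_le
  rw [length_initSeg] at hl
  rw [List.prefix_iff_eq_take.1 h, take_initSeg f hl, length_initSeg]

/-- A set that is not in the Laver ideal is not covered by any generator. -/
theorem not_subset_smallSet {A : Set (ℕ → ℕ)} (hA : A ∉ laverIdeal) (g : List ℕ → ℕ) :
    ¬ A ⊆ smallSet g :=
  fun h => hA fun _ hJ hg => hJ.subset_mem _ (hg g) _ h

/-- `B` is large at the node `s`: no `g` bounds infinitely often, from `s` on, all members of `B`
through `s`. -/
def LargeAt (B : Set (ℕ → ℕ)) (s : List ℕ) : Prop :=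
  ∀ g : List ℕ → ℕ, ∃ x ∈ B, initSeg x s.length = s ∧ ∀ n ≥ s.length, g (initSeg x n) ≤ x n

/-- Witnesses of failure chosen for all nodes at once, so that later a single function can dominate
many of them. Large nodes get the harmless value zero. -/
theorem exists_bound_of_not_largeAt (B : Set (ℕ → ℕ)) :
    ∃ G : List ℕ → List ℕ → ℕ, ∀ s, ¬ LargeAt B s → ∀ x ∈ B, initSeg x s.length = s →
      ∃ n ≥ s.length, x n < G s (initSeg x n) := by
  have h : ∀ s, ∃ g : List ℕ → ℕ, ¬ LargeAt B s → ∀ x ∈ B, initSeg x s.length = s →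
      ∃ n ≥ s.length, x n < g (initSeg x n) := by
    intro s
    by_cases hs : LargeAt B s
    · exact ⟨fun _ => 0, fun h => absurd hs h⟩
    · simp only [LargeAt] at hs
      push Not at hs
      obtain ⟨g, hg⟩ := hs
      exact ⟨g, fun _ => hg⟩
  choose G hG using h
  exact ⟨G, hG⟩

/-- If every node fails, take at `t` the maximum of the witnesses belonging to the initial segments
of `t`. Each initial segment of a member of `B` then forces a later failure, hence there are
infinitely many. -/
theorem exists_largeAt {B : Set (ℕ → ℕ)} (hB : ∀ g, ¬ B ⊆ smallSet g) : ∃ s, LargeAt B s := by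
  by_contra! hs
  obtain ⟨G, hG⟩ := exists_bound_of_not_largeAt B
  refine hB (fun t => (Finset.range (t.length + 1)).sup fun i => G (t.take i) t) fun x hx => ?_
  refine Set.infinite_of_forall_exists_gt fun m => ?_
  obtain ⟨n, hn, hlt⟩ := hG (initSeg x (m + 1)) (hs _) x hx (by rw [length_initSeg])
  rw [length_initSeg] at hn
  refine ⟨n, hlt.trans_le ?_, hn⟩
  have := Finset.le_sup (f := fun i => G ((initSeg x n).take i) (initSeg x n))
    (b := m + 1) (s := Finset.range (n + 1)) (by simp; omega)
  simpa [take_initSeg x hn, length_initSeg] using this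

theorem LargeAt.infinite_children {B : Set (ℕ → ℕ)} {s : List ℕ} (hs : LargeAt B s) :
    {k | LargeAt B (s ++ [k])}.Infinite := by
  intro hfin
  obtain ⟨b, hb⟩ := hfin.bddAbove
  obtain ⟨G, hG⟩ := exists_bound_of_not_largeAt B
  -- The value at `s` pushes `x` past all large successors; from there on, the witness of the
  -- non-large successor reached by `x` takes over.
  obtain ⟨x, hx, hxs, hxn⟩ := hs fun t =>
    if t.length = s.length then b + 1 else G (t.take (s.length + 1)) t
  have h0 := hxn s.length le_rfl
  rw [if_pos (length_initSeg _ _)] at h0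
  have hnot : ¬ LargeAt B (initSeg x (s.length + 1)) := by
    intro h
    rw [initSeg_succ, hxs] at h
    have := hb h
    omega
  obtain ⟨n, hn, hlt⟩ := hG _ hnot x hx (by rw [length_initSeg])
  rw [length_initSeg] at hn
  have h1 := hxn n (by omega)
  rw [if_neg (by rw [length_initSeg]; omega), take_initSeg x hn] at h1
  omega

/-! ### Ranks of nodes and decomposition of large sets -/

/-- `Reaches Z α s`: the set `Z` of nodes is reached from `s` by a tree of rank at most `α` that
branches infinitely at every node outside `Z`. -/
inductive Reaches (Z : List ℕ → Prop) : Ordinal.{0} → List ℕ → Prop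
  | base (α : Ordinal.{0}) (s : List ℕ) : Z s → Reaches Z α s
  | step (α : Ordinal.{0}) (s : List ℕ) (f : ℕ → ℕ) (b : ℕ → Ordinal.{0}) :
      f.Injective → (∀ n, b n < α) → (∀ n, Reaches Z (b n) (s ++ [f n])) → Reaches Z α s

theorem Reaches.of_infinite {Z : List ℕ → Prop} {s : List ℕ}
    (h : {k | ∃ α, Reaches Z α (s ++ [k])}.Infinite) : ∃ α, Reaches Z α s := by
  have hf := fun n => (h.natEmbedding _ n).2
  choose b hb using hf
  exact ⟨_, .step (⨆ n, Order.succ (b n)) s (fun n => (h.natEmbedding _ n : ℕ)) b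
    (Subtype.val_injective.comp (h.natEmbedding _).injective)
    (fun n => (Order.lt_succ _).trans_le (Ordinal.le_iSup (fun n => Order.succ (b n)) n)) hb⟩

/-- A node without a rank has only finitely many successors with one. A fast-growing `x` in `B` can
therefore avoid ranked nodes forever, so no piece is ever large along it; but `x` lies in some
piece, whose witness of failure it also outgrows. -/
theorem LargeAt.reaches_iUnion {B : Set (ℕ → ℕ)} {C : ℕ → Set (ℕ → ℕ)} (hC : B ⊆ ⋃ i, C i)
    {s : List ℕ} (hs : LargeAt B s) :
    ∃ α, Reaches (fun t => ∃ i, LargeAt (C i) t) α s := by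
  by_contra hnot
  set D : List ℕ → Prop := fun t => ∃ α, Reaches (fun t => ∃ i, LargeAt (C i) t) α t
  choose G hG using fun i => exists_bound_of_not_largeAt (C i)
  have hb : ∀ t, ∃ b, ¬ D t → ∀ k, D (t ++ [k]) → k < b := by
    intro t
    by_cases ht : D t
    · exact ⟨0, fun h => absurd ht h⟩
    · have hfin : {k | D (t ++ [k])}.Finite := by
        by_contra h
        exact ht (Reaches.of_infinite h)
      obtain ⟨b, hb⟩ := hfin.bddAbove
      exact ⟨b + 1, fun _ k hk => Nat.lt_succ_of_le (hb hk)⟩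
  choose b hb using hb
  -- The first term keeps `x` off the ranked nodes. The second dominates the witnesses of every
  -- piece `i` and initial segment of length `j` with `i` and `j` at most the length of `t`; below,
  -- `m` is at least `i`, so the pair `(i, m)` is covered from length `m` on.
  obtain ⟨x, hx, hxs, hxn⟩ := hs fun t => max (b t)
    ((Finset.range (t.length + 1) ×ˢ Finset.range (t.length + 1)).sup
      fun p => G p.1 (t.take p.2) t)
  have hD : ∀ n ≥ s.length, ¬ D (initSeg x n) := by
    intro n hn
    induction n, hn using Nat.le_induction with
    | base => rwa [hxs]
    | succ n hn ih =>
      intro h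
      rw [initSeg_succ] at h
      have := hb _ ih _ h
      have := (le_max_left _ _).trans (hxn n hn)
      omega
  obtain ⟨i, hi⟩ := Set.mem_iUnion.1 (hC hx)
  set m := max i s.length
  have hm : ¬ LargeAt (C i) (initSeg x m) :=
    fun h => hD m (le_max_right _ _) ⟨0, .base _ _ ⟨i, h⟩⟩
  obtain ⟨n, hn, hlt⟩ := hG i _ hm x hi (by rw [length_initSeg])
  rw [length_initSeg] at hn
  have h1 := (le_max_right _ _).trans (hxn n (by omega))
  have h2 := Finset.le_sup (f := fun p : ℕ × ℕ => G p.1 ((initSeg x n).take p.2) (initSeg x n))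
    (b := (i, m)) (s := Finset.range (n + 1) ×ˢ Finset.range (n + 1)) (by simp; omega)
  simp only [length_initSeg, take_initSeg x hn] at h1 h2
  omega

/-! ### Laver trees from labelled transitions -/

section Fusion

variable {L : Type*} (R : List ℕ → L → ℕ → L → Prop)

/-- The nodes and labels obtained from `(s, l)` by steps along `R`, the new label being chosen by
`nxt`. -/
inductive Run (nxt : List ℕ → L → ℕ → L) (s : List ℕ) (l : L) : List ℕ → L → Prop
  | root : Run nxt s l s l
  | step (t : List ℕ) (l' : L) (k : ℕ) : Run nxt s l t l' → R t l' k (nxt t l' k) →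
      Run nxt s l (t ++ [k]) (nxt t l' k)

variable {R} {nxt : List ℕ → L → ℕ → L} {s : List ℕ} {l : L}

theorem Run.prefix {t : List ℕ} {l' : L} (h : Run R nxt s l t l') : s <+: t := by
  induction h with
  | root => exact List.prefix_rfl
  | step t l' k _ _ ih => exact ih.trans (List.prefix_append _ _)

theorem Run.of_append {t : List ℕ} {k : ℕ} {l' : L} (hst : s <+: t)
    (h : Run R nxt s l (t ++ [k]) l') :
    ∃ l'', Run R nxt s l t l'' ∧ R t l'' k l' ∧ l' = nxt t l'' k := by
  generalize hu : t ++ [k] = u at h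
  cases h with
  | root => have := hst.length_le; simp [← hu] at this
  | step t' l'' k' h h' =>
    obtain ⟨rfl, rfl⟩ : t = t' ∧ k = k' := by simpa using hu
    exact ⟨l'', h, h', rfl⟩

/-- Labels are produced by the function `nxt`, so a node determines its label. This makes the labels
found separately at the nodes of a branch fit into one run. -/
theorem Run.unique {t : List ℕ} {l₁ l₂ : L} (h₁ : Run R nxt s l t l₁) (h₂ : Run R nxt s l t l₂) :
    l₁ = l₂ := by
  induction h₁ generalizing l₂ with
  | root =>
    generalize hu : s = u at h₂
    cases h₂ with
    | root => rfl
    | step t' l'' k' h h' => have := h.prefix.length_le; simp at this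
  | step t' l'' k' h h' ih =>
    obtain ⟨l₃, h₃, _, rfl⟩ := h₂.of_append h.prefix
    rw [ih h₃]

/-- A labelled transition system in which every valid label has infinitely many valid successors
yields a Laver tree, every branch of which carries a run of labels. -/
theorem exists_laverTree_of_transitions (V : List ℕ → L → Prop)
    (hV : ∀ t l, V t l → {k | ∃ l', V (t ++ [k]) l' ∧ R t l k l'}.Infinite)
    {s : List ℕ} {l : L} (hs : V s l) :
    ∃ T : Descriptive.tree ℕ, IsLaverTree T ∧ ∀ x ∈ branches T, ∃ lab : ℕ → L,
      ∀ n ≥ s.length, V (initSeg x n) (lab n) ∧ R (initSeg x n) (lab n) (x n) (lab (n + 1)) := by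
  classical
  have : ∀ t l k, ∃ l', (∃ l', V (t ++ [k]) l' ∧ R t l k l') → V (t ++ [k]) l' ∧ R t l k l' := by
    intro t l k
    by_cases h : ∃ l', V (t ++ [k]) l' ∧ R t l k l'
    · exact ⟨h.choose, fun _ => h.choose_spec⟩
    · exact ⟨l, fun h' => absurd h' h⟩
  choose nxt hnxt using this
  -- Validity is built into the transition, so every label occurring in a run is valid.
  set R' : List ℕ → L → ℕ → L → Prop := fun t l k l' => V (t ++ [k]) l' ∧ R t l k l'
  have hRunV : ∀ t l', Run R' nxt s l t l' → V t l' := by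
    intro t l' h
    cases h with
    | root => exact hs
    | step t l' k h h' => exact h'.1
  refine ⟨⟨{t | t <+: s ∨ ∃ l', Run R' nxt s l t l'}, ?_⟩, ⟨s, Or.inl List.prefix_rfl, ?_, ?_⟩, ?_⟩
  · rintro t k (h | ⟨l', h⟩)
    · exact Or.inl ((List.prefix_append _ _).trans h)
    · by_cases hst : s <+: t
      · obtain ⟨l'', h'', -⟩ := h.of_append hst
        exact Or.inr ⟨l'', h''⟩
      · refine Or.inl ?_
        rcases List.prefix_or_prefix_of_prefix h.prefix (List.prefix_append t [k]) with h' | h'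
        · exact absurd h' hst
        · exact h'
  · rintro t (h | ⟨l', h⟩)
    · exact Or.inl h
    · exact Or.inr h.prefix
  · rintro t ht hst
    have : ∃ l', Run R' nxt s l t l' := by
      rcases ht with h | h
      · rw [h.eq_of_length_le hst.length_le]
        exact ⟨l, .root⟩
      · exact h
    obtain ⟨l', hl'⟩ := this
    refine (hV t l' (hRunV _ _ hl')).mono fun k hk => Or.inr ⟨_, .step _ _ _ hl' (hnxt _ _ _ hk)⟩
  · intro x hx
    have hrun : ∀ n ≥ s.length, ∃ l', Run R' nxt s l (initSeg x n) l' := by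
      intro n hn
      rcases hx n with h | h
      · have hl := h.length_le
        rw [length_initSeg] at hl
        have := h.eq_of_length_le (by rw [length_initSeg]; exact hn)
        exact ⟨l, by rw [this]; exact .root⟩
      · exact h
    have : Nonempty L := ⟨l⟩
    choose! lab hlab using hrun
    refine ⟨lab, fun n hn => ⟨hRunV _ _ (hlab n hn), ?_⟩⟩
    have h1 := hlab (n + 1) (by omega)
    rw [initSeg_succ] at h1
    obtain ⟨l'', h2, h3, -⟩ := h1.of_append (hlab n hn).prefix
    rw [(hlab n hn).unique h2]
    exact h3.2

end Fusion

/-! ### Analytic sets -/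

/-- The part of the range of `φ` coming from the points through `u`. -/
def imageThrough (φ : (ℕ → ℕ) → ℕ → ℕ) (u : List ℕ) : Set (ℕ → ℕ) :=
  φ '' {y | initSeg y u.length = u}

theorem imageThrough_subset_iUnion (φ : (ℕ → ℕ) → ℕ → ℕ) (u : List ℕ) :
    imageThrough φ u ⊆ ⋃ i, imageThrough φ (u ++ [i]) := by
  rintro _ ⟨y, hy, rfl⟩
  refine Set.mem_iUnion.2 ⟨y u.length, y, ?_, rfl⟩
  simp only [Set.mem_ofPred_eq, List.length_append, List.length_singleton] at hy ⊢
  rw [initSeg_succ, hy]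

theorem imageThrough_append_subset (φ : (ℕ → ℕ) → ℕ → ℕ) (u : List ℕ) (i : ℕ) :
    imageThrough φ (u ++ [i]) ⊆ imageThrough φ u := by
  rintro _ ⟨y, hy, rfl⟩
  exact ⟨y, initSeg_eq_of_prefix (n := (u ++ [i]).length)
    (by rw [hy]; exact List.prefix_append _ _), rfl⟩

theorem Reaches.exists_mem {φ : (ℕ → ℕ) → ℕ → ℕ} {u : List ℕ} {α : Ordinal.{0}} {t : List ℕ}
    (h : Reaches (fun t => ∃ i, LargeAt (imageThrough φ (u ++ [i])) t) α t) :
    ∃ y, initSeg y u.length = u ∧ initSeg (φ y) t.length = t := by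
  induction h with
  | base α s h =>
    obtain ⟨i, hi⟩ := h
    obtain ⟨x, hx, hxs, -⟩ := hi fun _ => 0
    obtain ⟨y, hy, rfl⟩ := imageThrough_append_subset φ u i hx
    exact ⟨y, hy, hxs⟩
  | step α s f b _ _ _ ih =>
    obtain ⟨y, hy, hyt⟩ := ih 0
    exact ⟨y, hy, initSeg_eq_of_prefix (n := (s ++ [f 0]).length)
      (by rw [hyt]; exact List.prefix_append _ _)⟩

/-- In the base case some piece is already large at `t`: `u` is extended, and at each of the
infinitely many large successors that piece is decomposed anew, giving a new rank. In the other case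
`u` is kept and the rank drops. -/
theorem infinite_reaches_successors {φ : (ℕ → ℕ) → ℕ → ℕ} {u : List ℕ} {α : Ordinal.{0}}
    {t : List ℕ} (h : Reaches (fun t => ∃ i, LargeAt (imageThrough φ (u ++ [i])) t) α t) :
    {k | ∃ l : List ℕ × Ordinal.{0},
      Reaches (fun t => ∃ i, LargeAt (imageThrough φ (l.1 ++ [i])) t) l.2 (t ++ [k]) ∧
        ((∃ i, l.1 = u ++ [i]) ∨ l.1 = u ∧ l.2 < α)}.Infinite := by
  cases h with
  | base _ _ h =>
    obtain ⟨i, hi⟩ := h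
    refine hi.infinite_children.mono fun k hk => ?_
    obtain ⟨β, hβ⟩ := hk.reaches_iUnion (imageThrough_subset_iUnion φ _)
    exact ⟨(u ++ [i], β), hβ, Or.inl ⟨i, rfl⟩⟩
  | step _ _ f b hf hb h =>
    refine (Set.infinite_range_of_injective hf).mono ?_
    rintro _ ⟨n, rfl⟩
    exact ⟨(u, b n), h n, Or.inr ⟨rfl, hb n⟩⟩

theorem exists_initSeg_eq_of_growing (u : ℕ → List ℕ) (hu : ∀ n, u n <+: u (n + 1))
    (hlen : ∀ m, ∃ n, m ≤ (u n).length) : ∃ y, ∀ n, initSeg y (u n).length = u n := by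
  have hmono : ∀ m n, m ≤ n → u m <+: u n := by
    intro m n hmn
    induction n, hmn using Nat.le_induction with
    | base => exact List.prefix_rfl
    | succ n _ ih => exact ih.trans (hu n)
  choose N hN using fun m => hlen (m + 1)
  refine ⟨fun m => (u (N m))[m]'(hN m), fun n => List.ext_getElem (length_initSeg _ _) ?_⟩
  intro m h1 h2
  rw [getElem_initSeg]
  rcases le_total n (N m) with h | h
  · exact ((hmono _ _ h).getElem h2).symm
  · exact (hmono _ _ h).getElem (hN m)

/-- If a sequence of labels `(u, α)` grows in its first component at every step where the ordinal
does not decrease, then the first components grow beyond any length. -/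
theorem exists_length_ge_of_progress (l : ℕ → List ℕ × Ordinal.{0})
    (hl : ∀ n, (∃ i, (l (n + 1)).1 = (l n).1 ++ [i]) ∨
      (l (n + 1)).1 = (l n).1 ∧ (l (n + 1)).2 < (l n).2) (m : ℕ) :
    ∃ n, m ≤ ((l n).1).length := by
  induction m with
  | zero => exact ⟨0, Nat.zero_le _⟩
  | succ m ih =>
    obtain ⟨n, hn⟩ := ih
    by_contra! h
    -- If length `m + 1` is never reached, then from stage `n` on every step is rank-lowering, an
    -- infinite descent of ordinals.
    have key : ∀ j, ((l (n + j)).1).length = m ∧ (l (n + j + 1)).2 < (l (n + j)).2 := by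
      intro j
      induction j with
      | zero =>
        have h1 := h n
        have h2 := h (n + 1)
        refine ⟨by simp; omega, ?_⟩
        rcases hl n with ⟨i, hi⟩ | hi
        · rw [hi] at h2; simp at h2; omega
        · exact hi.2
      | succ j ih =>
        have hlen : ((l (n + (j + 1))).1).length = m := by
          have := h (n + j + 1)
          rcases hl (n + j) with ⟨i, hi⟩ | hi
          · rw [hi] at this; simp at this; omega
          · rw [← add_assoc, hi.1]; exact ih.1
        refine ⟨hlen, ?_⟩
        rcases hl (n + (j + 1)) with ⟨i, hi⟩ | hi
        · have := h (n + (j + 1) + 1)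
          rw [hi] at this; simp at this; omega
        · exact hi.2
    obtain ⟨j, hj⟩ := WellFounded.not_rel_apply_succ (r := ((· < ·) : Ordinal.{0} → _ → Prop))
      (fun j => (l (n + j)).2)
    exact hj (key j).2

/-- The approximations `z m` converge to `y` and their images to `x`; limits are unique. -/
theorem eq_of_approximations {φ : (ℕ → ℕ) → ℕ → ℕ} (hφ : Continuous φ) {x y : ℕ → ℕ}
    (h : ∀ m, ∃ z, initSeg z m = initSeg y m ∧ initSeg (φ z) m = initSeg x m) : φ y = x := by
  have agree : ∀ {a b : ℕ → ℕ} {m i : ℕ}, i < m → initSeg a m = initSeg b m → a i = b i := by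
    intro a b m i hi hab
    simp only [initSeg, List.map_inj_left, List.mem_range] at hab
    exact hab i hi
  have tends : ∀ {a : ℕ → ℕ → ℕ} {b : ℕ → ℕ}, (∀ m, initSeg (a m) m = initSeg b m) →
      Filter.Tendsto a Filter.atTop (nhds b) := by
    intro a b hab
    refine tendsto_pi_nhds.2 fun i => tendsto_const_nhds.congr' ?_
    filter_upwards [Filter.eventually_gt_atTop i] with m hm
    exact (agree hm (hab m)).symm
  choose z hz hzx using h
  exact tendsto_nhds_unique ((hφ.tendsto y).comp (tends hz)) (tends hzx)

/-- An analytic set that is not in the Laver ideal contains all branches of a Laver tree. -/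
theorem exists_laverTree_of_analyticSet {A : Set (ℕ → ℕ)} (hA : MeasureTheory.AnalyticSet A)
    (hpos : A ∉ laverIdeal) : ∃ T : Descriptive.tree ℕ, IsLaverTree T ∧ branches T ⊆ A := by
  rw [MeasureTheory.AnalyticSet] at hA
  obtain rfl | ⟨φ, hφ, rfl⟩ := hA
  · exact absurd (fun J hJ _ => hJ.empty_mem) hpos
  obtain ⟨s, hs⟩ := exists_largeAt (not_subset_smallSet hpos)
  have hs' : LargeAt (imageThrough φ []) s := by
    have : imageThrough φ [] = Set.range φ := by
      simp [imageThrough, initSeg]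
    rwa [this]
  obtain ⟨α, hα⟩ := hs'.reaches_iUnion (imageThrough_subset_iUnion φ _)
  obtain ⟨T, hT, hbr⟩ := exists_laverTree_of_transitions (L := List ℕ × Ordinal.{0})
    (R := fun _ l _ l' => (∃ i, l'.1 = l.1 ++ [i]) ∨ l'.1 = l.1 ∧ l'.2 < l.2)
    (fun t l => Reaches (fun t => ∃ i, LargeAt (imageThrough φ (l.1 ++ [i])) t) l.2 t)
    (fun t l h => infinite_reaches_successors h) (s := s) (l := ([], α)) hα
  refine ⟨T, hT, fun x hx => ?_⟩
  obtain ⟨lab, hlab⟩ := hbr x hx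
  have hprog := exists_length_ge_of_progress (fun n => lab (s.length + n))
    (fun n => (hlab (s.length + n) (by omega)).2)
  obtain ⟨y, hy⟩ := exists_initSeg_eq_of_growing (fun n => (lab (s.length + n)).1) (fun n => by
    rcases (hlab (s.length + n) (by omega)).2 with ⟨i, hi⟩ | hi
    · exact ⟨[i], hi.symm⟩
    · exact (congrArg (_ <+: ·) hi.1).mpr List.prefix_rfl) hprog
  refine ⟨y, eq_of_approximations hφ fun m => ?_⟩
  obtain ⟨n, hn⟩ := hprog m
  have hgrow : ∀ j, m ≤ ((lab (s.length + (n + j))).1).length := by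
    intro j
    induction j with
    | zero => exact hn
    | succ j ih =>
      rcases (hlab (s.length + (n + j)) (by omega)).2 with ⟨i, hi⟩ | hi
      · have := congrArg List.length hi
        simp only [List.length_append, List.length_singleton] at this
        rw [← add_assoc n, ← add_assoc s.length, this]
        omega
      · rw [← add_assoc n, ← add_assoc s.length, hi.1]; exact ih
  -- At this stage both the label and the node have length at least `m`.
  obtain ⟨z, hz, hzx⟩ := (hlab (s.length + (n + m)) (by omega)).1.exists_mem
  rw [length_initSeg] at hzx
  refine ⟨z, ?_, ?_⟩
  · rw [← take_initSeg z (hgrow m), ← take_initSeg y (hgrow m), hz, hy]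
  · rw [← take_initSeg (φ z) (by omega : m ≤ s.length + (n + m)), hzx, take_initSeg x (by omega)]

theorem exists_laverTree_of_borel {A : Set (ℕ → ℕ)}
    (hA : @MeasurableSet (ℕ → ℕ) (borel (ℕ → ℕ)) A) (hpos : A ∉ laverIdeal) :
    ∃ T : Descriptive.tree ℕ, IsLaverTree T ∧ branches T ⊆ A := by
  let _ : MeasurableSpace (ℕ → ℕ) := borel (ℕ → ℕ)
  have _ : BorelSpace (ℕ → ℕ) := ⟨rfl⟩
  exact exists_laverTree_of_analyticSet hA.analyticSet hpos

end Laver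

/-! ### Definability by instance search -/

namespace SetModel

section Definability

open FirstOrder FirstOrder.Language

variable {M : Type*} [Membership M M]

/-- A predicate on assignments `ℕ → M` that is first-order definable with parameters. Under a
quantifier, the variable `0` is the bound one and all others are shifted. -/
class Dfn (P : (ℕ → M) → Prop) : Prop where
  out : (Set.univ : Set M).Definable setLang {v | P v}

/-- A definable function on assignments: its graph is definable. -/
class DFun (t : (ℕ → M) → M) : Prop where
  out : Dfn fun v => v 0 = t fun n => v (n + 1)

theorem Dfn.of_iff {P Q : (ℕ → M) → Prop} (hP : Dfn P) (h : ∀ v, Q v ↔ P v) : Dfn Q := by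
  rwa [show Q = P from funext fun v => propext (h v)]

section

variable {P Q : (ℕ → M) → Prop}

instance Dfn.not [hP : Dfn P] : Dfn fun v => ¬ P v := ⟨hP.out.compl⟩

instance Dfn.and [hP : Dfn P] [hQ : Dfn Q] : Dfn fun v => P v ∧ Q v := ⟨hP.out.inter hQ.out⟩

instance Dfn.or [hP : Dfn P] [hQ : Dfn Q] : Dfn fun v => P v ∨ Q v := ⟨hP.out.union hQ.out⟩

instance Dfn.imp [Dfn P] [Dfn Q] : Dfn fun v => P v → Q v :=
  (inferInstance : Dfn fun v => ¬ P v ∨ Q v).of_iff fun _ => imp_iff_not_or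

instance Dfn.iff [Dfn P] [Dfn Q] : Dfn fun v => P v ↔ Q v :=
  (inferInstance : Dfn fun v => (P v → Q v) ∧ (Q v → P v)).of_iff fun _ =>
    iff_iff_implies_and_implies

theorem Dfn.rename (hP : Dfn P) (r : ℕ → ℕ) : Dfn fun v => P fun n => v (r n) :=
  ⟨hP.out.preimage_comp r⟩

instance Dfn.ex {P : (ℕ → M) → M → Prop} [hP : Dfn fun v => P (fun n => v (n + 1)) (v 0)] :
    Dfn fun v => ∃ x, P v x := by
  constructor
  have h := (hP.out.preimage_comp
    (fun n => Nat.casesOn n (Sum.inr ()) Sum.inl : ℕ → ℕ ⊕ Unit)).exists_of_finite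
  convert! h using 1
  ext v
  constructor
  · rintro ⟨x, hx⟩
    exact ⟨fun _ => x, hx⟩
  · rintro ⟨x, hx⟩
    exact ⟨x (), hx⟩

instance Dfn.all {P : (ℕ → M) → M → Prop} [Dfn fun v => P (fun n => v (n + 1)) (v 0)] :
    Dfn fun v => ∀ x, P v x :=
  (inferInstance : Dfn fun v => ¬ ∃ x, ¬ P v x).of_iff fun _ => not_exists_not.symm

instance DFun.var (i : ℕ) : DFun fun v : ℕ → M => v i :=
  ⟨⟨(Term.var 0).equal (Term.var (i + 1)), by ext; simp⟩⟩

instance (priority := 900) DFun.const (c : M) : DFun fun _ : ℕ → M => c :=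
  ⟨⟨(Term.var 0).equal (setLang.con (⟨c, trivial⟩ : (Set.univ : Set M))).term, by ext; simp⟩⟩

theorem DFun.rename {t : (ℕ → M) → M} (ht : DFun t) (r : ℕ → ℕ) :
    DFun fun v => t fun n => v (r n) :=
  ⟨ht.out.rename fun n => Nat.casesOn n 0 fun n => r n + 1⟩

/-- A term is eliminated through its graph by an existential quantifier. The composition lemmas
below iterate this, one argument at a time. -/
theorem Dfn.subst {P : (ℕ → M) → M → Prop} (hP : Dfn fun v => P (fun n => v (n + 1)) (v 0))
    {a : (ℕ → M) → M} (ha : DFun a) : Dfn fun v => P v (a v) := by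
  have := ha.out
  exact (inferInstance : Dfn fun v => ∃ x, x = a v ∧ P v x).of_iff fun v => by simp

theorem DFun.subst {t : (ℕ → M) → M → M} (ht : DFun fun v => t (fun n => v (n + 1)) (v 0))
    {a : (ℕ → M) → M} (ha : DFun a) : DFun fun v => t v (a v) :=
  ⟨Dfn.subst (P := fun v x => v 0 = t (fun n => v (n + 1)) x)
    (ht.out.rename fun n => Nat.casesOn n 1 fun n => Nat.casesOn n 0 fun n => n + 2)
    (ha.rename fun n => n + 1)⟩

section

variable {a b c : (ℕ → M) → M}

theorem Dfn.comp₁ {R : M → Prop} (hR : Dfn fun v => R (v 0)) (ha : DFun a) :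
    Dfn fun v => R (a v) :=
  Dfn.subst (P := fun _ x => R x) hR ha

theorem Dfn.comp₂ {R : M → M → Prop} (hR : Dfn fun v => R (v 0) (v 1)) (ha : DFun a)
    (hb : DFun b) : Dfn fun v => R (a v) (b v) :=
  Dfn.subst (P := fun v x => R (a v) x) (Dfn.subst (P := fun v x => R x (v 0)) (hR.rename fun n =>
    Nat.casesOn n 0 fun _ => 1) (ha.rename fun n => n + 1)) hb

theorem Dfn.comp₃ {R : M → M → M → Prop} (hR : Dfn fun v => R (v 0) (v 1) (v 2)) (ha : DFun a)
    (hb : DFun b) (hc : DFun c) : Dfn fun v => R (a v) (b v) (c v) :=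
  Dfn.subst (P := fun v x => R (a v) (b v) x) (Dfn.subst
    (P := fun v x => R (a fun n => v (n + 1)) x (v 0))
    (Dfn.subst (P := fun v x => R x (v 0) (v 1)) (hR.rename id)
      (ha.rename fun n => n + 2)) (hb.rename fun n => n + 1)) hc

theorem DFun.comp₁ {f : M → M} (hf : DFun fun v => f (v 0)) (ha : DFun a) :
    DFun fun v => f (a v) :=
  DFun.subst (t := fun _ x => f x) hf ha

theorem DFun.comp₂ {f : M → M → M} (hf : DFun fun v => f (v 0) (v 1)) (ha : DFun a)
    (hb : DFun b) : DFun fun v => f (a v) (b v) :=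
  DFun.subst (t := fun v x => f (a v) x) (DFun.subst (t := fun v x => f x (v 0)) (hf.rename fun n =>
    Nat.casesOn n 0 fun _ => 1) (ha.rename fun n => n + 1)) hb

theorem DFun.comp₃ {f : M → M → M → M} (hf : DFun fun v => f (v 0) (v 1) (v 2)) (ha : DFun a)
    (hb : DFun b) (hc : DFun c) : DFun fun v => f (a v) (b v) (c v) :=
  DFun.subst (t := fun v x => f (a v) (b v) x) (DFun.subst
    (t := fun v x => f (a fun n => v (n + 1)) x (v 0))
    (DFun.subst (t := fun v x => f x (v 0) (v 1)) (hf.rename id)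
      (ha.rename fun n => n + 2)) (hb.rename fun n => n + 1)) hc

instance Dfn.eq [ha : DFun a] [hb : DFun b] : Dfn fun v => a v = b v :=
  Dfn.comp₂ ⟨(Term.var 0).equal (Term.var 1), by ext; simp⟩ ha hb

instance Dfn.mem [ha : DFun a] [hb : DFun b] : Dfn fun v => a v ∈ b v :=
  Dfn.comp₂ (R := fun x y => x ∈ y) ⟨(setLang.lhomWithConstants (Set.univ : Set M)).onFormula
    (Relations.formula₂ (L := setLang) SetRel.mem (Term.var 0) (Term.var 1)), by
      ext v
      rw [Set.mem_ofPred_eq, Set.mem_ofPred_eq, LHom.realize_onFormula]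
      exact Iff.rfl⟩ ha hb

end

instance Dfn.existsUnique {P : (ℕ → M) → M → Prop}
    [h : Dfn fun v => P (fun n => v (n + 1)) (v 0)] : Dfn fun v => ∃! x, P v x := by
  have h2 : Dfn fun v => P (fun n => v (n + 1 + 1)) (v 0) :=
    h.rename fun n => Nat.casesOn n 0 fun n => n + 2
  unfold ExistsUnique
  infer_instance

end

section

variable {a b c : (ℕ → M) → M} [ha : DFun a] [hb : DFun b] [hc : DFun c]

instance : Dfn fun v => IsEmpty (a v) := .comp₁ (by unfold IsEmpty; infer_instance) ha

instance : Dfn fun v => IsSucc (a v) (b v) := .comp₂ (by unfold IsSucc; infer_instance) ha hb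

instance : Dfn fun v => IsUPair (a v) (b v) (c v) :=
  .comp₃ (by unfold IsUPair; infer_instance) ha hb hc

instance : Dfn fun v => IsPair (a v) (b v) (c v) :=
  .comp₃ (by unfold IsPair; infer_instance) ha hb hc

instance : Dfn fun v => IsInductive (a v) := .comp₁ (by unfold IsInductive; infer_instance) ha

instance : Dfn fun v => Val (a v) (b v) (c v) := .comp₃ (by unfold Val; infer_instance) ha hb hc

instance : Dfn fun v => IsFun (a v) (b v) (c v) :=
  .comp₃ (by unfold IsFun; infer_instance) ha hb hc

instance : Dfn fun v => IsFinSeq (a v) (b v) := .comp₂ (by unfold IsFinSeq; infer_instance) ha hb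

instance : Dfn fun v => IsReal (a v) (b v) := .comp₂ (by unfold IsReal; infer_instance) ha hb

end

end Definability

/-- `M` is a model of ZF, as a type class. -/
class ModelZF (M : Type*) [Membership M M] : Prop where
  isModelZF : IsModelZF M

/-! ### Set operations inside a model -/

section Sets

variable {M : Type*} [Membership M M]

theorem Dfn.definable₁ {P : M → Prop} (h : Dfn fun v => P (v 0)) :
    (Set.univ : Set M).Definable₁ setLang {x | P x} :=
  h.out.preimage_comp (fun _ => 0 : ℕ → Fin 1)

theorem Dfn.definable₂ {P : M → M → Prop} (h : Dfn fun v => P (v 0) (v 1)) :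
    (Set.univ : Set M).Definable₂ setLang {x | P x.1 x.2} :=
  h.out.preimage_comp (fun n => if n = 0 then 0 else 1 : ℕ → Fin 2)

variable [hM : ModelZF M]

theorem ext_mem {a b : M} (h : ∀ x, x ∈ a ↔ x ∈ b) : a = b := hM.isModelZF.extensionality a b h

theorem exists_isEmpty : ∃ e : M, IsEmpty e := by
  obtain ⟨w, ⟨e, -, he⟩, -⟩ := hM.isModelZF.infinity
  exact ⟨e, he⟩

/-- The empty set of `M`. -/
noncomputable def emp : M := exists_isEmpty.choose

@[simp] theorem not_mem_emp (x : M) : x ∉ (emp : M) := exists_isEmpty.choose_spec x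

/-- Definite description: the unique `x` with `P x`, and the empty set if there is none. -/
noncomputable def iota (P : M → Prop) : M := by
  classical exact if h : ∃! x, P x then h.choose else emp

theorem iota_spec {P : M → Prop} (h : ∃! x, P x) : P (iota P) := by
  rw [iota, dif_pos h]
  exact h.choose_spec.1

theorem iota_eq {P : M → Prop} {x : M} (hx : P x) (h : ∀ y, P y → y = x) : iota P = x :=
  h _ (iota_spec ⟨x, hx, h⟩)

theorem iota_of_not {P : M → Prop} (h : ¬ ∃! x, P x) : iota P = emp := by
  rw [iota, dif_neg h]

theorem iota_set {P : M → Prop} (h : ∃ b : M, ∀ x, x ∈ b ↔ P x) (x : M) :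
    x ∈ iota (fun b : M => ∀ x, x ∈ b ↔ P x) ↔ P x := by
  obtain ⟨b, hb⟩ := h
  rw [iota_eq (P := fun b => ∀ x, x ∈ b ↔ P x) hb fun c hc => ext_mem fun x => by rw [hb, hc], hb]

/-- The graph splits into the case of unique existence and the default case. Set operations
introduced by description inherit definability from this. -/
instance DFun.iota {P : (ℕ → M) → M → Prop} [h : Dfn fun v => P (fun n => v (n + 1)) (v 0)] :
    DFun fun v => iota (P v) := by
  have h1 : Dfn fun v => P (fun n => v (n + 1 + 1)) (v 0) :=
    h.rename fun n => Nat.casesOn n 0 fun n => n + 2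
  have h2 : Dfn fun v => P (fun n => v (n + 1)) (v 0) := h
  refine ⟨(inferInstance : Dfn fun v => P (fun n => v (n + 1)) (v 0) ∧
    (∃! x, P (fun n => v (n + 1)) x) ∨ (¬ ∃! x, P (fun n => v (n + 1)) x) ∧ v 0 = emp).of_iff
      fun v => ?_⟩
  by_cases hu : ∃! x, P (fun n => v (n + 1)) x
  · simp only [hu, and_true, not_true_eq_false, false_and, or_false]
    exact ⟨fun h => h ▸ iota_spec hu, fun h => hu.unique h (iota_spec hu)⟩
  · simp [hu, iota_of_not hu]

/-- `{x ∈ a | P x}` -/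
noncomputable def sep (a : M) (P : M → Prop) : M := iota fun b => ∀ x, x ∈ b ↔ x ∈ a ∧ P x

theorem mem_sep {a : M} {P : M → Prop} [h : Dfn fun v => P (v 0)] {x : M} :
    x ∈ sep a P ↔ x ∈ a ∧ P x :=
  iota_set (hM.isModelZF.separation _ h.definable₁ a) x

instance DFun.sep {a : (ℕ → M) → M} {P : (ℕ → M) → M → Prop} [ha : DFun a]
    [h : Dfn fun v => P (fun n => v (n + 1)) (v 0)] : DFun fun v => sep (a v) (P v) := by
  have h1 : Dfn fun v => P (fun n => v (n + 1 + 1)) (v 0) :=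
    h.rename fun n => Nat.casesOn n 0 fun n => n + 2
  have h2 := ha.rename (fun n => n + 1 + 1)
  unfold SetModel.sep
  infer_instance

/-- `{F x | x ∈ a}` -/
noncomputable def img (a : M) (F : M → M) : M := iota fun b => ∀ y, y ∈ b ↔ ∃ x ∈ a, y = F x

theorem mem_img {a : M} {F : M → M} [h : DFun fun v => F (v 0)] {y : M} :
    y ∈ img a F ↔ ∃ x ∈ a, y = F x := by
  refine iota_set (hM.isModelZF.replacement _ (Dfn.definable₂ (P := fun x y => y = F x)
    inferInstance) a fun x _ y z hy hz => ?_) y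
  exact Eq.trans hy (Eq.symm hz)

instance DFun.img {a : (ℕ → M) → M} {F : (ℕ → M) → M → M} [ha : DFun a]
    [h : DFun fun v => F (fun n => v (n + 1)) (v 0)] : DFun fun v => img (a v) (F v) := by
  have h1 : DFun fun v => F (fun n => v (n + 1 + 1 + 1)) (v 0) :=
    h.rename fun n => Nat.casesOn n 0 fun n => n + 3
  have h2 := ha.rename (fun n => n + 1 + 1 + 1)
  unfold SetModel.img
  infer_instance

/-- The unordered pair `{a, b}`. -/
noncomputable def upair (a b : M) : M := iota fun p => ∀ z, z ∈ p ↔ z = a ∨ z = b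

@[simp] theorem mem_upair {a b x : M} : x ∈ upair a b ↔ x = a ∨ x = b :=
  iota_set (hM.isModelZF.pairing a b) x

/-- The union `⋃ a`. -/
noncomputable def sUnion (a : M) : M := iota fun u => ∀ x, x ∈ u ↔ ∃ y ∈ a, x ∈ y

@[simp] theorem mem_sUnion {a x : M} : x ∈ sUnion a ↔ ∃ y ∈ a, x ∈ y :=
  iota_set (hM.isModelZF.union a) x

/-- The power set. -/
noncomputable def pow (a : M) : M := iota fun u => ∀ x, x ∈ u ↔ Sub x a

@[simp] theorem mem_pow {a x : M} : x ∈ pow a ↔ Sub x a :=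
  iota_set (hM.isModelZF.powerset a) x

/-- The ordered pair `(a, b)`. -/
noncomputable def opair (a b : M) : M := upair (upair a a) (upair a b)

/-- `a ∪ {b}` -/
noncomputable def adjoin (a b : M) : M := sUnion (upair a (upair b b))

@[simp] theorem mem_adjoin {a b x : M} : x ∈ adjoin a b ↔ x ∈ a ∨ x = b := by
  simp [adjoin]

/-- The successor `x ∪ {x}`. -/
noncomputable def succ (x : M) : M := adjoin x x

@[simp] theorem mem_succ {x y : M} : y ∈ succ x ↔ y ∈ x ∨ y = x := mem_adjoin

section

variable {a b c : (ℕ → M) → M} [ha : DFun a] [hb : DFun b] [hc : DFun c]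

instance : DFun fun v => upair (a v) (b v) := .comp₂ (by unfold upair; infer_instance) ha hb

instance : DFun fun v => sUnion (a v) := .comp₁ (by unfold sUnion; infer_instance) ha

instance : DFun fun v => opair (a v) (b v) := .comp₂ (by unfold opair; infer_instance) ha hb

instance : DFun fun v => adjoin (a v) (b v) := .comp₂ (by unfold adjoin; infer_instance) ha hb

instance : DFun fun v => succ (a v) := .comp₁ (by unfold succ; infer_instance) ha

end

theorem isEmpty_iff {e : M} : IsEmpty e ↔ e = emp :=
  ⟨fun h => ext_mem fun x => by simp [h x], fun h => h ▸ not_mem_emp⟩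

theorem isSucc_iff {x y : M} : IsSucc y x ↔ y = succ x :=
  ⟨fun h => ext_mem fun z => by rw [h z, mem_succ], fun h => h ▸ fun _ => mem_succ⟩

theorem isUPair_iff {p a b : M} : IsUPair p a b ↔ p = upair a b :=
  ⟨fun h => ext_mem fun z => by rw [h z, mem_upair], fun h => h ▸ fun _ => mem_upair⟩

theorem isPair_iff {p a b : M} : IsPair p a b ↔ p = opair a b := by
  simp [IsPair, isUPair_iff, opair]

theorem val_iff {f x y : M} : Val f x y ↔ opair x y ∈ f := by simp [Val, isPair_iff]

theorem upair_eq_upair {a b c d : M} (h : upair a b = upair c d) :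
    a = c ∧ b = d ∨ a = d ∧ b = c := by
  have h1 : ∀ x, x = a ∨ x = b ↔ x = c ∨ x = d := fun x => by rw [← mem_upair, h, mem_upair]
  have := h1 a
  have := h1 b
  have := h1 c
  have := h1 d
  grind

@[simp] theorem opair_inj {a b c d : M} : opair a b = opair c d ↔ a = c ∧ b = d := by
  refine ⟨fun h => ?_, fun h => by rw [h.1, h.2]⟩
  rcases upair_eq_upair h with ⟨h1, h2⟩ | ⟨h1, h2⟩
  · have h1 := upair_eq_upair h1
    have h2 := upair_eq_upair h2
    grind
  · have h1 := upair_eq_upair h1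
    have h2 := upair_eq_upair h2
    grind

/-- The restriction of the function `f` to `a`. -/
noncomputable def restr (f a : M) : M := sep f fun p => ∃ x ∈ a, ∃ y, p = opair x y

theorem mem_restr {f a p : M} : p ∈ restr f a ↔ p ∈ f ∧ ∃ x ∈ a, ∃ y, p = opair x y := mem_sep

theorem opair_mem_restr {f a x y : M} : opair x y ∈ restr f a ↔ opair x y ∈ f ∧ x ∈ a := by
  simp [mem_restr]

theorem isRestr_iff {r f a : M} : IsRestr r f a ↔ r = restr f a := by
  simp only [IsRestr, isPair_iff, ← mem_restr]
  exact ⟨ext_mem, fun h _ => h ▸ Iff.rfl⟩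

/-- The product `a × b`. -/
noncomputable def prod (a b : M) : M := sUnion (img a fun x => img b fun y => opair x y)

theorem mem_prod {a b p : M} : p ∈ prod a b ↔ ∃ x ∈ a, ∃ y ∈ b, p = opair x y := by
  simp [prod, mem_img]

/-- The function `x ↦ F x` on `a`. -/
noncomputable def lam (a : M) (F : M → M) : M := img a fun x => opair x (F x)

instance DFun.lam {a : (ℕ → M) → M} {F : (ℕ → M) → M → M} [ha : DFun a]
    [h : DFun fun v => F (fun n => v (n + 1)) (v 0)] : DFun fun v => lam (a v) (F v) := by
  unfold SetModel.lam
  infer_instance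

theorem mem_lam {a : M} {F : M → M} [h : DFun fun v => F (v 0)] {p : M} :
    p ∈ lam a F ↔ ∃ x ∈ a, p = opair x (F x) := mem_img

theorem opair_mem_lam {a : M} {F : M → M} [h : DFun fun v => F (v 0)] {x y : M} :
    opair x y ∈ lam a F ↔ x ∈ a ∧ y = F x := by
  simp [mem_lam]

/-- The value `f(x)`. -/
noncomputable def app (f x : M) : M := iota fun y => opair x y ∈ f

section

variable {a b c : (ℕ → M) → M} [ha : DFun a] [hb : DFun b] [hc : DFun c]

instance : DFun fun v => restr (a v) (b v) := .comp₂ (by unfold restr; infer_instance) ha hb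

instance : DFun fun v => app (a v) (b v) := .comp₂ (by unfold app; infer_instance) ha hb

end

theorem isFun_iff {f a b : M} : IsFun f a b ↔
    (∀ p ∈ f, ∃ x ∈ a, ∃ y ∈ b, p = opair x y) ∧ ∀ x ∈ a, ∃! y, opair x y ∈ f := by
  simp [IsFun, isPair_iff, val_iff]

namespace IsFun

variable {f g a b c x y p : M}

theorem opair_app_mem (h : IsFun f a b) (hx : x ∈ a) : opair x (app f x) ∈ f :=
  iota_spec ((isFun_iff.1 h).2 x hx)

theorem opair_mem_iff (h : IsFun f a b) : opair x y ∈ f ↔ x ∈ a ∧ y = app f x := by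
  constructor
  · intro hxy
    obtain ⟨x', hx', y', -, hp⟩ := (isFun_iff.1 h).1 _ hxy
    obtain ⟨rfl, -⟩ := opair_inj.1 hp
    exact ⟨hx', ((isFun_iff.1 h).2 _ hx').unique hxy (h.opair_app_mem hx')⟩
  · rintro ⟨hx, rfl⟩
    exact h.opair_app_mem hx

theorem app_mem (h : IsFun f a b) (hx : x ∈ a) : app f x ∈ b := by
  obtain ⟨x', -, y', hy', hp⟩ := (isFun_iff.1 h).1 _ (h.opair_app_mem hx)
  rw [(opair_inj.1 hp).2]
  exact hy'

theorem mem_iff (h : IsFun f a b) : p ∈ f ↔ ∃ x ∈ a, p = opair x (app f x) := by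
  constructor
  · intro hp
    obtain ⟨x, hx, y, -, rfl⟩ := (isFun_iff.1 h).1 _ hp
    exact ⟨x, hx, by rw [(h.opair_mem_iff.1 hp).2]⟩
  · rintro ⟨x, hx, rfl⟩
    exact h.opair_app_mem hx

theorem ext (hf : IsFun f a b) (hg : IsFun g a c) (h : ∀ x ∈ a, app f x = app g x) : f = g := by
  refine ext_mem fun p => ?_
  rw [hf.mem_iff, hg.mem_iff]
  exact exists_congr fun x => and_congr_right fun hx => by rw [h x hx]

theorem app_eq (h : IsFun f a b) (hxy : opair x y ∈ f) : app f x = y :=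
  (h.opair_mem_iff.1 hxy).2.symm

theorem domain_unique (hf : IsFun f a b) {a' b' : M} (hg : IsFun f a' b') : a = a' := by
  refine ext_mem fun x => ⟨fun hx => ?_, fun hx => ?_⟩
  · exact (hg.opair_mem_iff.1 (hf.opair_app_mem hx)).1
  · exact (hf.opair_mem_iff.1 (hg.opair_app_mem hx)).1

theorem restr (h : IsFun f a b) (hc : Sub c a) : IsFun (restr f c) c b := by
  refine isFun_iff.2 ⟨fun p hp => ?_, fun x hx => ⟨app f x, ?_, fun y hy => ?_⟩⟩
  · obtain ⟨hp, x, hx, y, rfl⟩ := mem_restr.1 hp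
    exact ⟨x, hx, y, by rw [(h.opair_mem_iff.1 hp).2]; exact h.app_mem (hc x hx), rfl⟩
  · exact opair_mem_restr.2 ⟨h.opair_app_mem (hc x hx), hx⟩
  · exact (h.app_eq (opair_mem_restr.1 hy).1).symm

theorem app_restr (h : IsFun f a b) (hc : Sub c a) (hx : x ∈ c) :
    app (SetModel.restr f c) x = app f x :=
  (h.restr hc).app_eq (opair_mem_restr.2 ⟨h.opair_app_mem (hc x hx), hx⟩)

theorem adjoin (h : IsFun f a b) (hx : x ∉ a) (hy : y ∈ b) :
    IsFun (adjoin f (opair x y)) (adjoin a x) b := by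
  refine isFun_iff.2 ⟨fun p hp => ?_, fun z hz => ?_⟩
  · rcases mem_adjoin.1 hp with hp | rfl
    · obtain ⟨z, hz, rfl⟩ := h.mem_iff.1 hp
      exact ⟨z, mem_adjoin.2 (Or.inl hz), _, h.app_mem hz, rfl⟩
    · exact ⟨x, mem_adjoin.2 (Or.inr rfl), y, hy, rfl⟩
  · rcases mem_adjoin.1 hz with hz | rfl
    · refine ⟨app f z, mem_adjoin.2 (Or.inl (h.opair_app_mem hz)), fun u hu => ?_⟩
      rcases mem_adjoin.1 hu with hu | hu
      · exact (h.app_eq hu).symm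
      · exact absurd ((opair_inj.1 hu).1 ▸ hz) hx
    · refine ⟨y, mem_adjoin.2 (Or.inr rfl), fun u hu => ?_⟩
      rcases mem_adjoin.1 hu with hu | hu
      · exact absurd (h.opair_mem_iff.1 hu).1 hx
      · exact (opair_inj.1 hu).2

end IsFun

section

variable {a b x : M} {F : M → M} [h : DFun fun v => F (v 0)]

theorem isFun_lam (hF : ∀ x ∈ a, F x ∈ b) : IsFun (lam a F) a b := by
  refine isFun_iff.2 ⟨fun p hp => ?_, fun x hx => ?_⟩
  · obtain ⟨x, hx, rfl⟩ := mem_lam.1 hp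
    exact ⟨x, hx, F x, hF x hx, rfl⟩
  · exact ⟨F x, opair_mem_lam.2 ⟨hx, rfl⟩, fun y hy => (opair_mem_lam.1 hy).2⟩

theorem app_lam (hx : x ∈ a) : app (lam a F) x = F x :=
  iota_eq (opair_mem_lam.2 ⟨hx, rfl⟩) fun _ hy => (opair_mem_lam.1 hy).2

end

/-! ### Natural numbers -/

theorem exists_isOmega : ∃ w : M, IsOmega w := by
  obtain ⟨u, hu⟩ := hM.isModelZF.infinity
  have hmem : ∀ x, x ∈ sep u (fun x => ∀ v : M, IsInductive v → x ∈ v) ↔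
      ∀ v, IsInductive v → x ∈ v := fun x => by
    rw [mem_sep]
    exact ⟨And.right, fun h => ⟨h u hu, h⟩⟩
  refine ⟨sep u fun x => ∀ v : M, IsInductive v → x ∈ v, ⟨?_, fun x hx => ?_⟩, fun v hv x hx =>
    (hmem x).1 hx v hv⟩
  · refine ⟨emp, (hmem _).2 fun v hv => ?_, not_mem_emp⟩
    obtain ⟨e, hev, he⟩ := hv.1
    rwa [isEmpty_iff.1 he] at hev
  · refine ⟨succ x, (hmem _).2 fun v hv => ?_, isSucc_iff.2 rfl⟩
    obtain ⟨y, hy, hyx⟩ := hv.2 x ((hmem x).1 hx v hv)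
    rwa [isSucc_iff.1 hyx] at hy

/-- The set `ω` of natural numbers of `M`. -/
noncomputable def om : M := exists_isOmega.choose

theorem isOmega_om : IsOmega (om : M) := exists_isOmega.choose_spec

theorem IsOmega.eq_om {w : M} (hw : IsOmega w) : w = om :=
  ext_mem fun _ => ⟨hw.2 _ isOmega_om.1 _, isOmega_om.2 _ hw.1 _⟩

theorem emp_mem_om : (emp : M) ∈ (om : M) := by
  obtain ⟨e, he, h⟩ := (isOmega_om (M := M)).1.1
  rwa [isEmpty_iff.1 h] at he

theorem succ_mem_om {n : M} (hn : n ∈ (om : M)) : succ n ∈ (om : M) := by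
  obtain ⟨y, hy, h⟩ := (isOmega_om (M := M)).1.2 n hn
  rwa [isSucc_iff.1 h] at hy

/-- Separation turns `P` into an inductive subset of `ω`, which must be all of `ω`; definability is
needed exactly for this. -/
theorem om_induction {P : M → Prop} [h : Dfn fun v => P (v 0)] (h0 : P emp)
    (hs : ∀ n ∈ (om : M), P n → P (succ n)) {n : M} (hn : n ∈ (om : M)) : P n := by
  refine (mem_sep.1 (isOmega_om.2 (sep om P) ⟨⟨emp, mem_sep.2 ⟨emp_mem_om, h0⟩, not_mem_emp⟩,
    fun x hx => ?_⟩ n hn)).2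
  obtain ⟨hx, hP⟩ := mem_sep.1 hx
  exact ⟨succ x, mem_sep.2 ⟨succ_mem_om hx, hs x hx hP⟩, isSucc_iff.2 rfl⟩

theorem exists_least {P : M → Prop} [h : Dfn fun v => P (v 0)] {n : M} (hn : n ∈ (om : M))
    (hP : P n) : ∃ m ∈ (om : M), P m ∧ ∀ k ∈ m, k ∈ (om : M) → ¬ P k := by
  obtain ⟨m, hm, hmin⟩ := hM.isModelZF.foundation (sep om P) ⟨n, mem_sep.2 ⟨hn, hP⟩⟩
  obtain ⟨hm, hPm⟩ := mem_sep.1 hm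
  exact ⟨m, hm, hPm, fun k hk hko hPk => hmin k hk (mem_sep.2 ⟨hko, hPk⟩)⟩

theorem mem_om_of_mem {n : M} (hn : n ∈ (om : M)) : ∀ m ∈ n, m ∈ (om : M) := by
  refine om_induction (P := fun n => ∀ m ∈ n, m ∈ om) (by simp) (fun n hn ih m hm => ?_) hn
  rcases mem_succ.1 hm with hm | rfl
  · exact ih m hm
  · exact hn

theorem mem_trans {k m n : M} (hn : n ∈ (om : M)) (hkm : k ∈ m) (hmn : m ∈ n) : k ∈ n := by
  refine om_induction (P := fun n => ∀ m ∈ n, ∀ k ∈ m, k ∈ n) (by simp)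
    (fun n hn ih m hm k hk => ?_) hn m hmn k hkm
  rcases mem_succ.1 hm with hm | rfl
  · exact mem_succ.2 (Or.inl (ih m hm k hk))
  · exact mem_succ.2 (Or.inl hk)

theorem not_mem_self (n : M) : n ∉ n := by
  intro h
  obtain ⟨x, hx, hmin⟩ := hM.isModelZF.foundation (upair n n) ⟨n, by simp⟩
  obtain rfl : x = n := by simpa using hx
  exact hmin x h (by simp)

theorem emp_mem_succ {n : M} (hn : n ∈ (om : M)) : emp ∈ succ n :=
  om_induction (P := fun n => emp ∈ succ n) (by simp)
    (fun _ _ ih => mem_succ.2 (Or.inl ih)) hn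

theorem succ_mem_succ {m n : M} (hn : n ∈ (om : M)) (h : m ∈ n) : succ m ∈ succ n := by
  refine om_induction (P := fun n => ∀ m ∈ n, succ m ∈ succ n) (by simp)
    (fun n hn ih m hm => ?_) hn m h
  rcases mem_succ.1 hm with hm | rfl
  · exact mem_succ.2 (Or.inl (ih m hm))
  · exact mem_succ.2 (Or.inr rfl)

theorem om_trichotomy {m n : M} (hm : m ∈ (om : M)) (hn : n ∈ (om : M)) :
    m ∈ n ∨ m = n ∨ n ∈ m := by
  refine om_induction (P := fun n => m ∈ n ∨ m = n ∨ n ∈ m) ?_ (fun n hn ih => ?_) hn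
  · have := emp_mem_succ hm
    rw [mem_succ] at this
    grind
  · rcases ih with h | rfl | h
    · exact Or.inl (mem_succ.2 (Or.inl h))
    · exact Or.inl (mem_succ.2 (Or.inr rfl))
    · have := succ_mem_succ hm h
      rw [mem_succ] at this
      grind

theorem succ_inj {m n : M} (h : succ m = succ n) : m = n := by
  have h1 : m ∈ succ n := h ▸ mem_succ.2 (Or.inr rfl)
  have h2 : n ∈ succ m := h ▸ mem_succ.2 (Or.inr rfl)
  rw [mem_succ] at h1 h2
  rcases h1 with h1 | h1
  · rcases h2 with h2 | h2
    · obtain ⟨x, hx, hmin⟩ := hM.isModelZF.foundation (upair m n) ⟨m, by simp⟩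
      rcases mem_upair.1 hx with rfl | rfl
      · exact absurd (by simp) (hmin _ h2)
      · exact absurd (by simp) (hmin _ h1)
    · exact h2.symm
  · exact h1

theorem eq_emp_or_succ {n : M} (hn : n ∈ (om : M)) : n = emp ∨ ∃ m ∈ (om : M), n = succ m :=
  om_induction (P := fun n => n = emp ∨ ∃ m ∈ om, n = succ m) (Or.inl rfl)
    (fun n hn _ => Or.inr ⟨n, hn, rfl⟩) hn

theorem sub_or_sub {m n : M} (hm : m ∈ (om : M)) (hn : n ∈ (om : M)) : Sub m n ∨ Sub n m := by
  rcases om_trichotomy hm hn with h | rfl | h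
  · exact Or.inl fun x hx => mem_trans hn hx h
  · exact Or.inl fun x hx => hx
  · exact Or.inr fun x hx => mem_trans hm hx h

end Sets

/-! ### Case distinction, sequences and strategies -/

section Runs

/-- `a` if `p` holds, and `b` otherwise. -/
noncomputable def sel {M : Type*} (p : Prop) (a b : M) : M := by classical exact if p then a else b

theorem sel_pos {M : Type*} {p : Prop} (h : p) (a b : M) : sel p a b = a := if_pos h

theorem sel_neg {M : Type*} {p : Prop} (h : ¬ p) (a b : M) : sel p a b = b := if_neg h

variable {M : Type*} [Membership M M]

theorem sel_mem {p : Prop} {a b c : M} (ha : p → a ∈ c) (hb : ¬ p → b ∈ c) : sel p a b ∈ c := by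
  by_cases h : p
  · rw [sel_pos h]
    exact ha h
  · rw [sel_neg h]
    exact hb h

instance DFun.sel {P : (ℕ → M) → Prop} {a b : (ℕ → M) → M} [hP : Dfn P] [ha : DFun a]
    [hb : DFun b] : DFun fun v => sel (P v) (a v) (b v) := by
  have := hP.rename (fun n => n + 1)
  have := ha.out
  have := hb.out
  refine ⟨(inferInstance : Dfn fun v => (P fun n => v (n + 1)) ∧ (v 0 = a fun n => v (n + 1)) ∨
    (¬ P fun n => v (n + 1)) ∧ (v 0 = b fun n => v (n + 1))).of_iff fun v => ?_⟩
  by_cases h : P fun n => v (n + 1) <;> simp [h, sel_pos, sel_neg]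

variable [hM : ModelZF M]

theorem om_strong_induction {P : M → Prop} [h : Dfn fun v => P (v 0)]
    (hs : ∀ n ∈ (om : M), (∀ m ∈ n, P m) → P n) {n : M} (hn : n ∈ (om : M)) : P n := by
  by_contra hP
  obtain ⟨m, hm, hPm, hmin⟩ := exists_least (P := fun n => ¬ P n) hn hP
  exact hPm (hs m hm fun k hk => not_not.1 (hmin k hk (mem_om_of_mem hm k hk)))

theorem sub_om {n : M} (hn : n ∈ (om : M)) : Sub n om := mem_om_of_mem hn

theorem sub_of_mem {m n : M} (hn : n ∈ (om : M)) (h : m ∈ n) : Sub m n :=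
  fun _ hk => mem_trans hn hk h

theorem mem_succ_self (n : M) : n ∈ succ n := mem_succ.2 (Or.inr rfl)

theorem succ_ne_emp (n : M) : succ n ≠ emp := fun h => by
  have := mem_succ_self n
  rw [h] at this
  exact not_mem_emp n this

/-! ### Finite sequences -/

/-- The length of a finite sequence of natural numbers. -/
noncomputable def dom (s : M) : M := iota fun n : M => n ∈ (om : M) ∧ IsFun s n om

/-- The set `ω^{<ω}`. -/
noncomputable def fs : M := sep (pow (prod om om)) fun s => IsFinSeq om s

/-- The set `ω^ω`. -/
noncomputable def reals : M := sep (pow (prod om om)) fun f => IsReal om f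

/-- The extension `s⌢⟨k⟩`. -/
noncomputable def snoc (s k : M) : M := adjoin s (opair (dom s) k)

section

variable {a b : (ℕ → M) → M} [ha : DFun a] [hb : DFun b]

instance : DFun fun v => dom (a v) := .comp₁ (by unfold dom; infer_instance) ha

instance : DFun fun v => snoc (a v) (b v) := .comp₂ (by unfold snoc; infer_instance) ha hb

end

theorem dom_eq {s n : M} (hn : n ∈ (om : M)) (hs : IsFun s n om) : dom s = n :=
  iota_eq ⟨hn, hs⟩ fun _ h => h.2.domain_unique hs

theorem mem_fs {s : M} : s ∈ (fs : M) ↔ IsFinSeq om s := by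
  refine mem_sep.trans ⟨And.right, fun h => ⟨mem_pow.2 fun p hp => ?_, h⟩⟩
  obtain ⟨n, hn, hs⟩ := h
  obtain ⟨x, hx, y, hy, rfl⟩ := (isFun_iff.1 hs).1 p hp
  exact mem_prod.2 ⟨x, mem_om_of_mem hn x hx, y, hy, rfl⟩

theorem mem_reals {f : M} : f ∈ (reals : M) ↔ IsReal om f := by
  refine mem_sep.trans ⟨And.right, fun h => ⟨mem_pow.2 fun p hp => ?_, h⟩⟩
  obtain ⟨x, hx, y, hy, rfl⟩ := (isFun_iff.1 h).1 p hp
  exact mem_prod.2 ⟨x, hx, y, hy, rfl⟩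

theorem mem_fs_of_isFun {s n : M} (hn : n ∈ (om : M)) (hs : IsFun s n om) : s ∈ (fs : M) :=
  mem_fs.2 ⟨n, hn, hs⟩

theorem dom_mem_om {s : M} (hs : s ∈ (fs : M)) : dom s ∈ (om : M) := by
  obtain ⟨n, hn, h⟩ := mem_fs.1 hs
  rwa [dom_eq hn h]

theorem isFun_dom {s : M} (hs : s ∈ (fs : M)) : IsFun s (dom s) om := by
  obtain ⟨n, hn, h⟩ := mem_fs.1 hs
  rwa [dom_eq hn h]

theorem app_of_not_mem {f a b x : M} (hf : IsFun f a b) (hx : x ∉ a) : app f x = emp :=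
  iota_of_not fun ⟨_, hy, _⟩ => hx (hf.opair_mem_iff.1 hy).1

/-- Outside the domain `app` returns `emp`, which is the number zero. Strategies may thus consult a
finite sequence beyond its length. -/
theorem app_mem_om {f a : M} (hf : IsFun f a om) (x : M) : app f x ∈ (om : M) := by
  by_cases hx : x ∈ a
  · exact hf.app_mem hx
  · rw [app_of_not_mem hf hx]
    exact emp_mem_om

theorem isFun_snoc {s k : M} (hs : s ∈ (fs : M)) (hk : k ∈ (om : M)) :
    IsFun (snoc s k) (succ (dom s)) om :=
  (isFun_dom hs).adjoin (not_mem_self _) hk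

theorem snoc_mem_fs {s k : M} (hs : s ∈ (fs : M)) (hk : k ∈ (om : M)) : snoc s k ∈ (fs : M) :=
  mem_fs_of_isFun (succ_mem_om (dom_mem_om hs)) (isFun_snoc hs hk)

theorem dom_snoc {s k : M} (hs : s ∈ (fs : M)) (hk : k ∈ (om : M)) :
    dom (snoc s k) = succ (dom s) :=
  dom_eq (succ_mem_om (dom_mem_om hs)) (isFun_snoc hs hk)

theorem app_snoc_dom {s k : M} (hs : s ∈ (fs : M)) (hk : k ∈ (om : M)) :
    app (snoc s k) (dom s) = k :=
  (isFun_snoc hs hk).app_eq (mem_adjoin.2 (Or.inr rfl))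

theorem app_snoc {s k i : M} (hs : s ∈ (fs : M)) (hk : k ∈ (om : M)) (hi : i ∈ dom s) :
    app (snoc s k) i = app s i :=
  (isFun_snoc hs hk).app_eq (mem_adjoin.2 (Or.inl ((isFun_dom hs).opair_app_mem hi)))

theorem isSnoc_snoc {s k : M} (hs : s ∈ (fs : M)) : IsSnoc om (snoc s k) s k :=
  ⟨dom s, dom_mem_om hs, isFun_dom hs, fun p => by simp [snoc, isPair_iff]⟩

theorem isSeqFun_iff {g : M} : IsSeqFun om g ↔ IsFun g fs om := by
  simp only [IsSeqFun, isFun_iff, isPair_iff, val_iff, ← mem_fs]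
  refine and_congr_left fun _ => forall₂_congr fun p _ => ⟨?_, ?_⟩
  · rintro ⟨s, k, hs, hk, h⟩
    exact ⟨s, hs, k, hk, h⟩
  · rintro ⟨s, hs, k, hk, h⟩
    exact ⟨s, k, hs, hk, h⟩

theorem obeys_iff {σ x n : M} (hσ : IsFun σ fs om) (hx : IsReal om x) (hn : n ∈ (om : M)) :
    Obeys σ x n ↔ app x n = app σ (restr x n) := by
  have hr : restr x n ∈ (fs : M) := mem_fs_of_isFun hn (IsFun.restr hx (sub_om hn))
  simp [Obeys, isRestr_iff, val_iff, IsFun.opair_mem_iff hx, hσ.opair_mem_iff, hn, hr]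

/-! ### The run of a strategy -/

/-- `s` is a sequence of length `n` (or a real, for `n = ω`) whose moves are all prescribed
by `ρ`. -/
def Follows (ρ s n : M) : Prop := IsFun s n om ∧ ∀ i ∈ n, app s i = app ρ (restr s i)

/-- The initial segment of length `n` of the run in which all moves are prescribed by `ρ`. -/
noncomputable def pos (ρ n : M) : M := iota fun s : M => Follows ρ s n

/-- The run in which all moves are prescribed by `ρ`. -/
noncomputable def play (ρ : M) : M := lam om fun n => app ρ (pos ρ n)

section

variable {a b c : (ℕ → M) → M} [ha : DFun a] [hb : DFun b] [hc : DFun c]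

instance : Dfn fun v => Follows (a v) (b v) (c v) :=
  .comp₃ (by unfold Follows; infer_instance) ha hb hc

instance : DFun fun v => pos (a v) (b v) := .comp₂ (by unfold pos; infer_instance) ha hb

end

theorem restr_restr {s m n : M} (h : Sub m n) : restr (restr s n) m = restr s m := by
  refine ext_mem fun p => ?_
  simp only [mem_restr]
  constructor
  · rintro ⟨⟨hp, -⟩, h'⟩
    exact ⟨hp, h'⟩
  · rintro ⟨hp, x, hx, y, rfl⟩
    exact ⟨⟨hp, x, h x hx, y, rfl⟩, x, hx, y, rfl⟩

theorem restr_eq_of_sub {f a b c : M} (hf : IsFun f a b) (h : Sub a c) : restr f c = f :=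
  ext_mem fun p => mem_restr.trans ⟨And.left, fun hp => ⟨hp, by
    obtain ⟨x, hx, hpx⟩ := hf.mem_iff.1 hp
    exact ⟨x, h x hx, _, hpx⟩⟩⟩

theorem restr_snoc {s k : M} (hs : s ∈ (fs : M)) (hk : k ∈ (om : M)) :
    restr (snoc s k) (dom s) = s :=
  have hsub : Sub (dom s) (succ (dom s)) := fun _ h => mem_succ.2 (Or.inl h)
  ((isFun_snoc hs hk).restr hsub).ext (isFun_dom hs) fun i hi => by
    rw [(isFun_snoc hs hk).app_restr hsub hi, app_snoc hs hk hi]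

/-- Strong induction: agreement below `i` gives equal positions at `i`, hence equal moves. Only
positions shorter than `n` are consulted, which is what allows strategies that diverge later to be
compared. -/
theorem Follows.restr_eq {ρ ρ' s s' n : M} (hn : Sub n om) (htr : ∀ i ∈ n, Sub i n)
    (h : Follows ρ s n) (h' : Follows ρ' s' n)
    (hρ : ∀ q ∈ (fs : M), dom q ∈ n → app ρ q = app ρ' q) : s = s' := by
  refine h.1.ext h'.1 fun i hi => ?_
  refine om_strong_induction (P := fun i => i ∈ n → app s i = app s' i) (fun i hio ih hi => ?_)
    (hn i hi) hi
  have hr := h.1.restr (htr i hi)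
  have hr' := h'.1.restr (htr i hi)
  have heq : restr s i = restr s' i := hr.ext hr' fun j hj => by
    rw [h.1.app_restr (htr i hi) hj, h'.1.app_restr (htr i hi) hj, ih j hj (htr i hi j hj)]
  rw [h.2 i hi, h'.2 i hi, ← heq, hρ _ (mem_fs_of_isFun hio hr) (by rwa [dom_eq hio hr])]

theorem Follows.restr {ρ s n m : M} (h : Follows ρ s n) (hm : Sub m n) (htr : ∀ i ∈ m, Sub i m) :
    Follows ρ (restr s m) m :=
  ⟨h.1.restr hm, fun i hi => by rw [h.1.app_restr hm hi, h.2 i (hm i hi), restr_restr (htr i hi)]⟩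

theorem Follows.snoc {ρ s : M} (hρ : IsFun ρ fs om) (hs : s ∈ (fs : M))
    (h : Follows ρ s (dom s)) : Follows ρ (snoc s (app ρ s)) (succ (dom s)) := by
  have hk := hρ.app_mem hs
  refine ⟨isFun_snoc hs hk, fun i hi => ?_⟩
  have hsub : Sub i (dom s) := by
    rcases mem_succ.1 hi with hi | rfl
    · exact sub_of_mem (dom_mem_om hs) hi
    · exact fun _ => id
  rw [← restr_restr hsub, restr_snoc hs hk]
  rcases mem_succ.1 hi with hi | rfl
  · rw [app_snoc hs hk hi, h.2 i hi]
  · rw [app_snoc_dom hs hk, restr_eq_of_sub (isFun_dom hs) fun _ => id]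

theorem exists_follows {ρ n : M} (hρ : IsFun ρ fs om) (hn : n ∈ (om : M)) : ∃ s, Follows ρ s n := by
  refine om_induction (P := fun n => ∃ s, Follows ρ s n) ?_ (fun n hn ih => ?_) hn
  · exact ⟨emp, isFun_iff.2 (by simp), by simp⟩
  · obtain ⟨s, hs⟩ := ih
    have hd := dom_eq hn hs.1
    refine ⟨SetModel.snoc s (app ρ s), ?_⟩
    have := Follows.snoc hρ (mem_fs_of_isFun hn hs.1) (by rwa [hd])
    rwa [hd] at this

theorem follows_pos {ρ n : M} (hρ : IsFun ρ fs om) (hn : n ∈ (om : M)) : Follows ρ (pos ρ n) n := by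
  obtain ⟨s, hs⟩ := exists_follows hρ hn
  exact iota_spec (P := fun s => Follows ρ s n) ⟨s, hs, fun s' hs' =>
    Follows.restr_eq (sub_om hn) (fun _ => sub_of_mem hn) hs' hs fun _ _ _ => rfl⟩

theorem Follows.eq_pos {ρ s n : M} (hρ : IsFun ρ fs om) (hn : n ∈ (om : M)) (hs : Follows ρ s n) :
    s = pos ρ n :=
  hs.restr_eq (sub_om hn) (fun _ => sub_of_mem hn) (follows_pos hρ hn) fun _ _ _ => rfl

theorem pos_mem_fs {ρ n : M} (hρ : IsFun ρ fs om) (hn : n ∈ (om : M)) : pos ρ n ∈ (fs : M) :=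
  mem_fs_of_isFun hn (follows_pos hρ hn).1

theorem dom_pos {ρ n : M} (hρ : IsFun ρ fs om) (hn : n ∈ (om : M)) : dom (pos ρ n) = n :=
  dom_eq hn (follows_pos hρ hn).1

theorem restr_pos {ρ m n : M} (hρ : IsFun ρ fs om) (hm : m ∈ (om : M)) (hn : n ∈ (om : M))
    (h : Sub m n) : restr (pos ρ n) m = pos ρ m :=
  ((follows_pos hρ hn).restr h fun _ => sub_of_mem hm).eq_pos hρ hm

theorem app_pos {ρ m n : M} (hρ : IsFun ρ fs om) (hn : n ∈ (om : M)) (h : m ∈ n) :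
    app (pos ρ n) m = app ρ (pos ρ m) := by
  rw [(follows_pos hρ hn).2 m h, restr_pos hρ (mem_om_of_mem hn m h) hn (sub_of_mem hn h)]

theorem pos_succ {ρ n : M} (hρ : IsFun ρ fs om) (hn : n ∈ (om : M)) :
    pos ρ (succ n) = snoc (pos ρ n) (app ρ (pos ρ n)) := by
  have h := Follows.snoc hρ (pos_mem_fs hρ hn) (by rw [dom_pos hρ hn]; exact follows_pos hρ hn)
  rw [dom_pos hρ hn] at h
  exact (h.eq_pos hρ (succ_mem_om hn)).symm

theorem pos_congr {ρ ρ' n : M} (hρ : IsFun ρ fs om) (hρ' : IsFun ρ' fs om) (hn : n ∈ (om : M))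
    (h : ∀ q ∈ (fs : M), dom q ∈ n → app ρ q = app ρ' q) : pos ρ n = pos ρ' n :=
  (follows_pos hρ hn).restr_eq (sub_om hn) (fun _ => sub_of_mem hn) (follows_pos hρ' hn) h

theorem isReal_play {ρ : M} (hρ : IsFun ρ fs om) : IsReal om (play ρ) :=
  isFun_lam fun _ hn => hρ.app_mem (pos_mem_fs hρ hn)

theorem app_play {ρ n : M} (hn : n ∈ (om : M)) : app (play ρ) n = app ρ (pos ρ n) := app_lam hn

theorem restr_play {ρ n : M} (hρ : IsFun ρ fs om) (hn : n ∈ (om : M)) :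
    restr (play ρ) n = pos ρ n := by
  have hr : IsFun (play ρ) om om := isReal_play hρ
  refine (hr.restr (sub_om hn)).ext (follows_pos hρ hn).1 fun i hi => ?_
  rw [hr.app_restr (sub_om hn) hi, app_play (mem_om_of_mem hn i hi), app_pos hρ hn hi]

/-- Definition by recursion of a function from `ω` to `ω`. -/
theorem exists_rec {c : M} (hc : c ∈ (om : M)) (G : M → M) [DFun fun v => G (v 0)]
    (hG : ∀ y ∈ (om : M), G y ∈ (om : M)) :
    ∃ f : M, IsReal om f ∧ app f emp = c ∧ ∀ n ∈ (om : M), app f (succ n) = G (app f n) := by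
  have hd2 : DFun fun v : ℕ → M => G (v 0) := inferInstance
  have hd3 : DFun fun v : ℕ → M => G (app (v 2) (v 0)) :=
    hd2.comp₁ inferInstance
  -- Recursion becomes the run of a strategy: at the empty position play `c`, otherwise apply `G` to
  -- the last move.
  set F : M → M := fun s => iota fun y : M =>
    dom s = emp ∧ y = c ∨ ∃ m : M, m ∈ (om : M) ∧ dom s = succ m ∧ y = G (app s m) with hF
  have hFd : DFun fun v => F (v 0) := by
    change DFun fun v : ℕ → M => iota fun y => dom (v 0) = emp ∧ y = c ∨
      ∃ m : M, m ∈ (om : M) ∧ dom (v 0) = succ m ∧ y = G (app (v 0) m)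
    infer_instance
  have hF0 : ∀ s, dom s = emp → F s = c := fun s hs =>
    iota_eq (Or.inl ⟨hs, rfl⟩) fun y hy => by
      rcases hy with hy | ⟨m, -, hm, -⟩
      · exact hy.2
      · exact absurd (hm.symm.trans hs) (succ_ne_emp m)
  have hFs : ∀ s, ∀ m ∈ (om : M), dom s = succ m → F s = G (app s m) := fun s m hm hs =>
    iota_eq (Or.inr ⟨m, hm, hs, rfl⟩) fun y hy => by
      rcases hy with hy | ⟨m', -, hm', rfl⟩
      · exact absurd (hs.symm.trans hy.1) (succ_ne_emp m)
      · rw [succ_inj (hs.symm.trans hm')]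
  have hρ : IsFun (lam fs F) fs om := isFun_lam fun s hs => by
    rcases eq_emp_or_succ (dom_mem_om hs) with h | ⟨m, hm, h⟩
    · rwa [hF0 s h]
    · rw [hFs s m hm h]
      exact hG _ (app_mem_om (isFun_dom hs) m)
  have happ : ∀ n ∈ (om : M), app (play (lam fs F)) n = F (pos (lam fs F) n) := fun n hn => by
    rw [app_play hn, app_lam (pos_mem_fs hρ hn)]
  refine ⟨play (lam fs F), isReal_play hρ, ?_, fun n hn => ?_⟩
  · rw [happ _ emp_mem_om, hF0 _ (dom_pos hρ emp_mem_om)]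
  · have hs := succ_mem_om hn
    rw [happ _ hs, hFs _ n hn (dom_pos hρ hs), app_pos hρ hs (mem_succ_self n), app_play hn]

/-! ### Parity -/

theorem exists_isEvens : ∃ e : M, IsEvens om e := by
  -- Alternate between zero and one; the even numbers are those with value zero.
  obtain ⟨f, -, h0, hs⟩ := exists_rec (M := M) emp_mem_om
    (fun y : M => sel (y = emp) (succ emp) emp)
    (fun y _ => sel_mem (fun _ => succ_mem_om emp_mem_om) fun _ => emp_mem_om)
  refine ⟨sep om fun n : M => app f n = emp, fun x hx => (mem_sep.1 hx).1, fun z hz => ?_,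
    fun n hn m hm => ?_⟩
  · rw [isEmpty_iff.1 hz]
    exact mem_sep.2 ⟨emp_mem_om, h0⟩
  · rw [isSucc_iff.1 hm, mem_sep, mem_sep, hs n hn]
    by_cases h : app f n = emp <;> simp [h, hn, succ_mem_om hn, succ_ne_emp, sel_pos, sel_neg]

/-- The set of even numbers. -/
noncomputable def evens : M := exists_isEvens.choose

theorem isEvens_evens : IsEvens om (evens : M) := exists_isEvens.choose_spec

theorem emp_mem_evens : (emp : M) ∈ (evens : M) := isEvens_evens.2.1 _ not_mem_emp

theorem succ_mem_evens {n : M} (hn : n ∈ (om : M)) : succ n ∈ (evens : M) ↔ n ∉ (evens : M) :=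
  isEvens_evens.2.2 n hn _ (isSucc_iff.2 rfl)

theorem exists_double : ∃ f : M, IsReal om f ∧ app f emp = emp ∧
    ∀ n ∈ (om : M), app f (succ n) = succ (succ (app f n)) :=
  exists_rec emp_mem_om (fun y => succ (succ y)) fun _ hy => succ_mem_om (succ_mem_om hy)

/-- Doubling: `i ↦ 2i`. -/
noncomputable def dbl (i : M) : M := app exists_double.choose i

/-- `i ↦ 2i + 1` -/
noncomputable def oddIdx (i : M) : M := succ (dbl i)

/-- `i ↦ 2i + 2` -/
noncomputable def evenIdx (i : M) : M := succ (succ (dbl i))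

section

variable {a : (ℕ → M) → M} [ha : DFun a]

instance : DFun fun v => dbl (a v) := .comp₁ (by unfold dbl; infer_instance) ha

instance : DFun fun v => oddIdx (a v) := .comp₁ (by unfold oddIdx; infer_instance) ha

instance : DFun fun v => evenIdx (a v) := .comp₁ (by unfold evenIdx; infer_instance) ha

end

theorem dbl_emp : dbl (emp : M) = emp := (exists_double (M := M)).choose_spec.2.1

theorem dbl_succ {i : M} (hi : i ∈ (om : M)) : dbl (succ i) = evenIdx i :=
  (exists_double (M := M)).choose_spec.2.2 i hi

theorem dbl_mem_om {i : M} (hi : i ∈ (om : M)) : dbl i ∈ (om : M) :=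
  IsFun.app_mem (exists_double (M := M)).choose_spec.1 hi

theorem oddIdx_mem_om {i : M} (hi : i ∈ (om : M)) : oddIdx i ∈ (om : M) :=
  succ_mem_om (dbl_mem_om hi)

theorem evenIdx_mem_om {i : M} (hi : i ∈ (om : M)) : evenIdx i ∈ (om : M) :=
  succ_mem_om (oddIdx_mem_om hi)

theorem dbl_mem_evens {i : M} (hi : i ∈ (om : M)) : dbl i ∈ (evens : M) := by
  refine om_induction (P := fun i => dbl i ∈ evens) ?_ (fun i hi ih => ?_) hi
  · rw [dbl_emp]
    exact emp_mem_evens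
  · rw [dbl_succ hi, evenIdx, succ_mem_evens (succ_mem_om (dbl_mem_om hi)),
      succ_mem_evens (dbl_mem_om hi)]
    exact not_not.2 ih

theorem oddIdx_not_mem_evens {i : M} (hi : i ∈ (om : M)) : oddIdx i ∉ (evens : M) := by
  rw [oddIdx, succ_mem_evens (dbl_mem_om hi)]
  exact not_not.2 (dbl_mem_evens hi)

theorem evenIdx_mem_evens {i : M} (hi : i ∈ (om : M)) : evenIdx i ∈ (evens : M) := by
  rw [← dbl_succ hi]
  exact dbl_mem_evens (succ_mem_om hi)

theorem exists_eq_dbl_or_oddIdx {n : M} (hn : n ∈ (om : M)) :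
    ∃ i ∈ (om : M), n = dbl i ∨ n = oddIdx i := by
  refine om_induction (P := fun n => ∃ i ∈ om, n = dbl i ∨ n = oddIdx i) ?_ (fun n hn ih => ?_) hn
  · exact ⟨emp, emp_mem_om, Or.inl dbl_emp.symm⟩
  · obtain ⟨i, hi, rfl | rfl⟩ := ih
    · exact ⟨i, hi, Or.inr rfl⟩
    · exact ⟨succ i, succ_mem_om hi, Or.inl (dbl_succ hi).symm⟩

theorem eq_emp_or_evenIdx {n : M} (hn : n ∈ (om : M)) (he : n ∈ (evens : M)) :
    n = emp ∨ ∃ i ∈ (om : M), n = evenIdx i := by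
  obtain ⟨i, hi, rfl | rfl⟩ := exists_eq_dbl_or_oddIdx hn
  · rcases eq_emp_or_succ hi with rfl | ⟨j, hj, rfl⟩
    · exact Or.inl dbl_emp
    · exact Or.inr ⟨j, hj, dbl_succ hj⟩
  · exact absurd he (oddIdx_not_mem_evens hi)

theorem exists_eq_oddIdx {n : M} (hn : n ∈ (om : M)) (he : n ∉ (evens : M)) :
    ∃ i ∈ (om : M), n = oddIdx i := by
  obtain ⟨i, hi, rfl | rfl⟩ := exists_eq_dbl_or_oddIdx hn
  · exact absurd (dbl_mem_evens hi) he
  · exact ⟨i, hi, rfl⟩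

theorem dbl_mem_dbl {i j : M} (hj : j ∈ (om : M)) (h : i ∈ j) : dbl i ∈ dbl j := by
  refine om_induction (P := fun j => ∀ i ∈ j, dbl i ∈ dbl j) (by simp) (fun j hj ih i hi => ?_)
    hj i h
  rw [dbl_succ hj, evenIdx, mem_succ, mem_succ]
  rcases mem_succ.1 hi with hi | rfl
  · exact Or.inl (Or.inl (ih i hi))
  · exact Or.inl (Or.inr rfl)

theorem mem_of_dbl_mem_dbl {i j : M} (hi : i ∈ (om : M)) (hj : j ∈ (om : M))
    (h : dbl i ∈ dbl j) : i ∈ j := by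
  rcases om_trichotomy hi hj with h' | rfl | h'
  · exact h'
  · exact absurd h (not_mem_self _)
  · exact absurd (mem_trans (dbl_mem_om hj) (dbl_mem_dbl hi h') h) (not_mem_self _)

theorem dbl_inj {i j : M} (hi : i ∈ (om : M)) (hj : j ∈ (om : M)) (h : dbl i = dbl j) : i = j := by
  rcases om_trichotomy hi hj with h' | h' | h'
  · exact absurd (h ▸ dbl_mem_dbl hj h') (not_mem_self _)
  · exact h'
  · exact absurd (h ▸ dbl_mem_dbl hi h') (not_mem_self _)

theorem mem_of_succ_mem_succ {m n : M} (hn : n ∈ (om : M))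
    (h : succ m ∈ succ n) : m ∈ n := by
  rcases mem_succ.1 h with h | h
  · exact mem_trans hn (mem_succ_self m) h
  · exact h ▸ mem_succ_self m

theorem oddIdx_mem_oddIdx {i j : M} (hi : i ∈ (om : M)) (hj : j ∈ (om : M))
    (h : oddIdx i ∈ oddIdx j) : i ∈ j :=
  mem_of_dbl_mem_dbl hi hj (mem_of_succ_mem_succ (dbl_mem_om hj) h)

theorem mem_succ_of_oddIdx_mem_evenIdx {i j : M} (hi : i ∈ (om : M)) (hj : j ∈ (om : M))
    (h : oddIdx i ∈ evenIdx j) : i ∈ succ j := by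
  rcases mem_succ.1 h with h | h
  · exact mem_succ.2 (Or.inl (oddIdx_mem_oddIdx hi hj h))
  · exact mem_succ.2 (Or.inr (dbl_inj hi hj (succ_inj h)))

theorem mem_of_evenIdx_mem_oddIdx {i j : M} (hi : i ∈ (om : M)) (hj : j ∈ (om : M))
    (h : evenIdx i ∈ oddIdx j) : i ∈ j := by
  have h1 : oddIdx i ∈ dbl j := mem_of_succ_mem_succ (dbl_mem_om hj) h
  exact mem_of_dbl_mem_dbl hi hj (mem_trans (dbl_mem_om hj) (mem_succ_self _) h1)

/-- The `i` with `n = 2i + 1`. -/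
noncomputable def oddInv (n : M) : M := iota fun i : M => i ∈ (om : M) ∧ n = oddIdx i

/-- The `i` with `n = 2i + 2`. -/
noncomputable def evenInv (n : M) : M := iota fun i : M => i ∈ (om : M) ∧ n = evenIdx i

section

variable {a : (ℕ → M) → M} [ha : DFun a]

instance : DFun fun v => oddInv (a v) := .comp₁ (by unfold oddInv; infer_instance) ha

instance : DFun fun v => evenInv (a v) := .comp₁ (by unfold evenInv; infer_instance) ha

end

theorem oddInv_oddIdx {i : M} (hi : i ∈ (om : M)) : oddInv (oddIdx i) = i :=
  iota_eq ⟨hi, rfl⟩ fun _ h => (dbl_inj hi h.1 (succ_inj h.2)).symm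

theorem evenInv_evenIdx {i : M} (hi : i ∈ (om : M)) : evenInv (evenIdx i) = i :=
  iota_eq ⟨hi, rfl⟩ fun _ h => (dbl_inj hi h.1 (succ_inj (succ_inj h.2))).symm

theorem evenIdx_ne_emp (i : M) : evenIdx i ≠ emp := succ_ne_emp _

end Runs

/-! ### The Laver game inside a model -/

section Game

variable {M : Type*} [Membership M M] [hM : ModelZF M]

theorem IsFun.sub_of_app_eq {f g a b a' b' : M} (hf : IsFun f a b) (hg : IsFun g a' b')
    (ha : Sub a a') (h : ∀ x ∈ a, app f x = app g x) : Sub f g := by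
  intro p hp
  obtain ⟨x, hx, rfl⟩ := hf.mem_iff.1 hp
  rw [h x hx]
  exact hg.opair_app_mem (ha x hx)

theorem pos_emp {ρ : M} (hρ : IsFun ρ fs om) : pos ρ emp = emp :=
  ext_mem fun p => by
    rw [(follows_pos hρ emp_mem_om).1.mem_iff]
    simp

theorem mem_of_not_mem_succ {m k : M} (hm : m ∈ (om : M)) (hk : k ∈ (om : M))
    (h : k ∉ succ m) : m ∈ k := by
  rcases om_trichotomy hm hk with h' | h' | h'
  · exact h'
  · exact absurd (mem_succ.2 (Or.inr h'.symm)) h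
  · exact absurd (mem_succ.2 (Or.inl h')) h

/-- The sequence `i ↦ z(2i + 2)`. -/
noncomputable def decode (z : M) : M := lam om fun i => app z (evenIdx i)

instance {a : (ℕ → M) → M} [ha : DFun a] : DFun fun v => decode (a v) :=
  .comp₁ (by unfold decode; infer_instance) ha

theorem app_decode {z i : M} (hi : i ∈ (om : M)) : app (decode z) i = app z (evenIdx i) :=
  app_lam hi

theorem isReal_decode {z : M} (hz : IsReal om z) : IsReal om (decode z) :=
  isFun_lam fun _ hi => IsFun.app_mem hz (evenIdx_mem_om hi)

/-- The payoff set of the Laver game for `A`. Player I first plays the length `N` of the trunk;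
then player II plays bounds `z(2i + 1)` and player I the values `z(2i + 2)` of an element of `A`,
which have to respect the bounds from the `N`-th one on. -/
noncomputable def payoff (A : M) : M := sep reals fun z => decode z ∈ A ∧
  ∀ i ∈ (om : M), i ∉ app z emp → app z (evenIdx i) ∉ app z (oddIdx i)

theorem mem_payoff {A z : M} : z ∈ payoff A ↔ IsReal om z ∧ decode z ∈ A ∧
    ∀ i ∈ (om : M), i ∉ app z emp → app z (evenIdx i) ∉ app z (oddIdx i) := by
  rw [payoff, mem_sep, mem_reals]

/-! ### A winning strategy of player II -/

/-- Player I plays `N` and then `x`, against the strategy `τ` of player II. -/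
noncomputable def answer (τ N x : M) : M := lam fs fun s =>
  sel (dom s ∈ (evens : M)) (sel (dom s = emp) N (app x (evenInv (dom s)))) (app τ s)

/-- The bound played by `τ` after player I has played `N` and the finite sequence `s`. -/
noncomputable def answerBound (τ s N : M) : M := app τ (pos (answer τ N s) (oddIdx (dom s)))

/-- The supremum of the bounds played by `τ` after player I has played the finite sequence `s` with
any declared length of the trunk that is at most the length of `s`. -/
noncomputable def boundFun (τ : M) : M := lam fs fun s =>
  sUnion (img (succ (dom s)) fun N => answerBound τ s N)

section

variable {a b c : (ℕ → M) → M} [ha : DFun a] [hb : DFun b] [hc : DFun c]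

instance : DFun fun v => answer (a v) (b v) (c v) :=
  .comp₃ (by unfold answer; infer_instance) ha hb hc

instance : DFun fun v => answerBound (a v) (b v) (c v) :=
  .comp₃ (by unfold answerBound; infer_instance) ha hb hc

end

theorem app_answer_even {τ N x q i : M} (hq : q ∈ (fs : M)) (hi : i ∈ (om : M))
    (h : dom q = evenIdx i) : app (answer τ N x) q = app x i := by
  rw [answer, app_lam hq, h, sel_pos (evenIdx_mem_evens hi), sel_neg (evenIdx_ne_emp i),
    evenInv_evenIdx hi]

theorem app_answer_emp {τ N x q : M} (hq : q ∈ (fs : M)) (h : dom q = emp) :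
    app (answer τ N x) q = N := by
  rw [answer, app_lam hq, h, sel_pos emp_mem_evens, sel_pos rfl]

theorem app_answer_odd {τ N x q : M} (hq : q ∈ (fs : M)) (h : dom q ∉ (evens : M)) :
    app (answer τ N x) q = app τ q := by
  rw [answer, app_lam hq, sel_neg h]

theorem isFun_answer {τ N x a : M} (hτ : IsFun τ fs om) (hN : N ∈ (om : M)) (hx : IsFun x a om) :
    IsFun (answer τ N x) fs om :=
  isFun_lam fun _ hq => sel_mem (fun _ => sel_mem (fun _ => hN) fun _ => app_mem_om hx _)
    fun _ => hτ.app_mem hq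

/-- Von Neumann naturals are nested, so a finite union of them is their maximum. -/
theorem sUnion_img_mem_om {F : M → M} [DFun fun v => F (v 0)]
    (hF : ∀ i ∈ (om : M), F i ∈ (om : M)) {n : M} (hn : n ∈ (om : M)) :
    sUnion (img n F) ∈ (om : M) := by
  have h2 : DFun fun v : ℕ → M => F (v 0) := inferInstance
  have h3 : DFun fun v : ℕ → M => img (v 0) F :=
    DFun.img (F := fun _ x => F x)
  refine om_induction (P := fun n => sUnion (img n F) ∈ (om : M)) ?_ (fun n hn ih => ?_) hn
  · rw [show sUnion (img emp F) = (emp : M) from ext_mem fun x => by simp [mem_img]]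
    exact emp_mem_om
  · have h : ∀ x, x ∈ sUnion (img (succ n) F) ↔ x ∈ sUnion (img n F) ∨ x ∈ F n := fun x => by
      simp only [mem_sUnion, mem_img, mem_succ]
      grind
    rcases sub_or_sub ih (hF n hn) with h' | h'
    · rw [show sUnion (img (succ n) F) = F n from ext_mem fun x =>
        (h x).trans ⟨fun hx => hx.elim (h' x) id, Or.inr⟩]
      exact hF n hn
    · rw [show sUnion (img (succ n) F) = sUnion (img n F) from ext_mem fun x =>
        (h x).trans ⟨fun hx => hx.elim id (h' x), Or.inl⟩]
      exact ih

theorem answerBound_mem_om {τ s N : M} (hτ : IsFun τ fs om) (hs : s ∈ (fs : M))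
    (hN : N ∈ (om : M)) : answerBound τ s N ∈ (om : M) :=
  hτ.app_mem (pos_mem_fs (isFun_answer hτ hN (isFun_dom hs)) (oddIdx_mem_om (dom_mem_om hs)))

theorem isFun_boundFun {τ : M} (hτ : IsFun τ fs om) : IsFun (boundFun τ) fs om := by
  refine isFun_lam fun s hs => ?_
  have hsub : Sub (succ (dom s)) om := sub_om (succ_mem_om (dom_mem_om hs))
  have : img (succ (dom s)) (fun N => answerBound τ s N) =
      img (succ (dom s)) fun N => sel (N ∈ (om : M)) (answerBound τ s N) emp :=
    ext_mem fun y => by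
      rw [mem_img, mem_img]
      exact exists_congr fun N => and_congr_right fun hN => by rw [sel_pos (hsub N hN)]
  rw [this]
  exact sUnion_img_mem_om
    (fun N _ => sel_mem (fun hN => answerBound_mem_om hτ hs hN) fun _ => emp_mem_om)
    (succ_mem_om (dom_mem_om hs))

theorem mem_boundFun {τ s N k : M} (hs : s ∈ (fs : M)) (hN : N ∈ succ (dom s))
    (hk : k ∈ answerBound τ s N) : k ∈ app (boundFun τ) s := by
  rw [boundFun, app_lam hs, mem_sUnion]
  exact ⟨_, mem_img.2 ⟨N, hN, rfl⟩, hk⟩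

/-- Before move `2i + 1` player I has only used `x(j)` with `2j + 2 < 2i + 1`, that is, `j < i`. -/
theorem pos_answer_restr {τ N x i : M} (hτ : IsFun τ fs om) (hN : N ∈ (om : M))
    (hx : IsReal om x) (hi : i ∈ (om : M)) :
    pos (answer τ N (restr x i)) (oddIdx i) = pos (answer τ N x) (oddIdx i) := by
  have hsub : Sub i om := sub_om hi
  refine pos_congr (isFun_answer hτ hN (IsFun.restr hx hsub)) (isFun_answer hτ hN hx)
    (oddIdx_mem_om hi) fun q hq hqi => ?_
  by_cases he : dom q ∈ (evens : M)
  · rcases eq_emp_or_evenIdx (dom_mem_om hq) he with h | ⟨j, hj, h⟩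
    · rw [app_answer_emp hq h, app_answer_emp hq h]
    · rw [app_answer_even hq hj h, app_answer_even hq hj h]
      rw [h] at hqi
      exact IsFun.app_restr hx hsub (mem_of_evenIdx_mem_oddIdx hj hi hqi)
  · rw [app_answer_odd hq he, app_answer_odd hq he]

/-- If player II wins the Laver game for `A`, then `A` is covered by one generator of the Laver
ideal. -/
theorem exists_bound_of_winning {A τ : M} (hA : IsSetOfReals om A) (hτ : IsFun τ fs om)
    (hwin : ∀ x : M, IsReal om x → (∀ n ∈ (om : M), n ∉ (evens : M) → Obeys τ x n) →
      x ∉ payoff A) {x m : M} (hx : x ∈ A) (hm : m ∈ (om : M)) :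
    ∃ i ∈ (om : M), m ∈ i ∧ app x i ∈ app (boundFun τ) (restr x i) := by
  have hxr := hA x hx
  -- Player I declares trunk length `m + 1`, so the bound that is violated in this lost run has
  -- index above `m`.
  have hN := succ_mem_om hm
  have hρ := isFun_answer hτ hN hxr
  set ρ := answer τ (succ m) x with hρdef
  have hz := isReal_play hρ
  have hval : ∀ i ∈ (om : M), app (play ρ) (evenIdx i) = app x i := fun i hi => by
    rw [app_play (evenIdx_mem_om hi),
      app_answer_even (pos_mem_fs hρ (evenIdx_mem_om hi)) hi (dom_pos hρ (evenIdx_mem_om hi))]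
  have hdec : decode (play ρ) = x := IsFun.ext (isReal_decode hz) hxr fun i hi => by
    rw [app_decode hi, hval i hi]
  have hodd : ∀ n ∈ (om : M), n ∉ (evens : M) → app (play ρ) n = app τ (pos ρ n) :=
    fun n hn he => by
      rw [app_play hn, app_answer_odd (pos_mem_fs hρ hn) (by rwa [dom_pos hρ hn])]
  have hnot := hwin (play ρ) hz fun n hn he => (obeys_iff hτ hz hn).2 (by
    rw [restr_play hρ hn, hodd n hn he])
  rw [mem_payoff] at hnot
  push Not at hnot
  obtain ⟨i, hi, hiN, hlt⟩ := hnot hz (by rwa [hdec])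
  rw [app_play emp_mem_om, app_answer_emp (pos_mem_fs hρ emp_mem_om) (dom_pos hρ emp_mem_om)] at hiN
  have hmi := mem_of_not_mem_succ hm hi hiN
  have hr := IsFun.restr hxr (sub_om hi)
  have hd := dom_eq hi hr
  refine ⟨i, hi, hmi, mem_boundFun (mem_fs_of_isFun hi hr) (N := succ m) ?_ ?_⟩
  · rw [hd]
    exact succ_mem_succ hi hmi
  · rw [hval i hi, hodd _ (oddIdx_mem_om hi) (oddIdx_not_mem_evens hi)] at hlt
    rwa [answerBound, hd, pos_answer_restr hτ hN hxr hi]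

theorem exists_isSmallSet {g : M} (hg : IsFun g fs om) : ∃ X : M, IsSmallSet om g X ∧
    ∀ f, IsReal om f → (∀ m ∈ (om : M), ∃ n ∈ (om : M), m ∈ n ∧ app f n ∈ app g (restr f n)) →
      f ∈ X := by
  refine ⟨sep reals fun f => ∀ m ∈ (om : M), ∃ n ∈ (om : M), m ∈ n ∧ app f n ∈ app g (restr f n),
    fun f => ?_, fun f hf h => mem_sep.2 ⟨mem_reals.2 hf, h⟩⟩
  rw [mem_sep, mem_reals]
  refine and_congr_right fun hf => forall₂_congr fun m _ => exists_congr fun n =>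
    and_congr_right fun hn => and_congr_right fun _ => ?_
  have hr : restr f n ∈ (fs : M) := mem_fs_of_isFun hn (IsFun.restr hf (sub_om hn))
  simp [isRestr_iff, val_iff, IsFun.opair_mem_iff hf, hg.opair_mem_iff, hn, hr]

/-! ### A winning strategy of player I -/

/-- The least `m` to which `σ` replies by `k` at the position `s`. -/
noncomputable def leastReply (σ s k : M) : M := iota fun m : M => m ∈ (om : M) ∧
  app σ (snoc s m) = k ∧ ∀ j ∈ m, app σ (snoc s j) ≠ k

/-- Against the strategy `σ` of player I, player II plays `0` in the first `N` rounds, and then the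
least move by which `σ` is led to play the next value of `t`. -/
noncomputable def lead (σ N t : M) : M := lam fs fun s =>
  sel (dom s ∈ (evens : M)) (app σ s)
    (sel (oddInv (dom s) ∈ N) emp (leastReply σ s (app t (oddInv (dom s)))))

/-- Against the strategy `σ` of player I, player II plays as in `lead` in the first `n` rounds, and
then always `c`. -/
noncomputable def leadThen (σ N t n c : M) : M := lam fs fun s =>
  sel (dom s ∈ (evens : M)) (app σ s) (sel (oddInv (dom s) ∈ n) (app (lead σ N t) s) c)

/-- The tree of the sequences produced by `σ` against `lead`. -/
noncomputable def leadTree (σ : M) : M := sep fs fun t => ∀ i ∈ dom t,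
  app σ (pos (lead σ (app σ emp) t) (evenIdx i)) = app t i

section

variable {a b c : (ℕ → M) → M} [ha : DFun a] [hb : DFun b] [hc : DFun c]

instance : DFun fun v => leastReply (a v) (b v) (c v) :=
  .comp₃ (by unfold leastReply; infer_instance) ha hb hc

instance : DFun fun v => lead (a v) (b v) (c v) :=
  .comp₃ (by unfold lead; infer_instance) ha hb hc

end

theorem leastReply_mem_om (σ s k : M) : leastReply σ s k ∈ (om : M) := by
  by_cases h : ∃! m : M, m ∈ (om : M) ∧ app σ (snoc s m) = k ∧ ∀ j ∈ m, app σ (snoc s j) ≠ k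
  · exact (iota_spec h).1
  · rw [leastReply, iota_of_not h]
    exact emp_mem_om

theorem app_snoc_leastReply {σ s k m : M} (hm : m ∈ (om : M)) (h : app σ (snoc s m) = k) :
    app σ (snoc s (leastReply σ s k)) = k := by
  obtain ⟨l, hl, hlk, hmin⟩ := exists_least (P := fun m => app σ (snoc s m) = k) hm h
  have hmin' : ∀ j ∈ l, app σ (snoc s j) ≠ k := fun j hj => hmin j hj (mem_om_of_mem hl j hj)
  refine (iota_spec (P := fun m : M => m ∈ (om : M) ∧ app σ (snoc s m) = k ∧
    ∀ j ∈ m, app σ (snoc s j) ≠ k) ⟨l, ⟨hl, hlk, hmin'⟩, ?_⟩).2.1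
  rintro l' ⟨hl', hlk', hmin''⟩
  rcases om_trichotomy hl hl' with h1 | h1 | h1
  · exact absurd hlk (hmin'' l h1)
  · exact h1.symm
  · exact absurd hlk' (hmin' l' h1)

section

variable {σ : M}

theorem isFun_lead (hσ : IsFun σ fs om) (N t : M) : IsFun (lead σ N t) fs om :=
  isFun_lam fun _ hq => sel_mem (fun _ => hσ.app_mem hq)
    fun _ => sel_mem (fun _ => emp_mem_om) fun _ => leastReply_mem_om _ _ _

theorem isFun_leadThen (hσ : IsFun σ fs om) (N t n : M) {c : M} (hc : c ∈ (om : M)) :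
    IsFun (leadThen σ N t n c) fs om :=
  isFun_lam fun _ hq => sel_mem (fun _ => hσ.app_mem hq)
    fun _ => sel_mem (fun _ => (isFun_lead hσ N t).app_mem hq) fun _ => hc

variable {N t n c q i : M}

theorem app_lead_even (hq : q ∈ (fs : M)) (h : dom q ∈ (evens : M)) :
    app (lead σ N t) q = app σ q := by
  rw [lead, app_lam hq, sel_pos h]

theorem app_leadThen_even (hq : q ∈ (fs : M)) (h : dom q ∈ (evens : M)) :
    app (leadThen σ N t n c) q = app σ q := by
  rw [leadThen, app_lam hq, sel_pos h]

theorem app_lead_odd (hq : q ∈ (fs : M)) (hi : i ∈ (om : M)) (h : dom q = oddIdx i) :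
    app (lead σ N t) q = sel (i ∈ N) emp (leastReply σ q (app t i)) := by
  rw [lead, app_lam hq, h, sel_neg (oddIdx_not_mem_evens hi), oddInv_oddIdx hi]

theorem app_leadThen_odd (hq : q ∈ (fs : M)) (hi : i ∈ (om : M)) (h : dom q = oddIdx i) :
    app (leadThen σ N t n c) q = sel (i ∈ n) (app (lead σ N t) q) c := by
  rw [leadThen, app_lam hq, h, sel_neg (oddIdx_not_mem_evens hi), oddInv_oddIdx hi]

/-- `lead` reads `t(j)` only for move `2j + 1`. Hence the condition on `t` at `i` in `leadTree`
depends only on the first `i + 1` values of `t`. -/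
theorem pos_lead_congr (hσ : IsFun σ fs om) {t' : M} (hn : n ∈ (om : M))
    (h : ∀ j ∈ (om : M), oddIdx j ∈ n → app t j = app t' j) :
    pos (lead σ N t) n = pos (lead σ N t') n := by
  refine pos_congr (isFun_lead hσ N t) (isFun_lead hσ N t') hn fun q hq hqn => ?_
  by_cases he : dom q ∈ (evens : M)
  · rw [app_lead_even hq he, app_lead_even hq he]
  · obtain ⟨j, hj, hqj⟩ := exists_eq_oddIdx (dom_mem_om hq) he
    rw [app_lead_odd hq hj hqj, app_lead_odd hq hj hqj, h j hj (hqj ▸ hqn)]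

theorem pos_leadThen (hσ : IsFun σ fs om) (hc : c ∈ (om : M)) {l : M} (hl : l ∈ (om : M))
    (h : ∀ j ∈ (om : M), oddIdx j ∈ l → j ∈ n) :
    pos (leadThen σ N t n c) l = pos (lead σ N t) l := by
  refine pos_congr (isFun_leadThen hσ N t n hc) (isFun_lead hσ N t) hl fun q hq hql => ?_
  by_cases he : dom q ∈ (evens : M)
  · rw [app_leadThen_even hq he, app_lead_even hq he]
  · obtain ⟨j, hj, hqj⟩ := exists_eq_oddIdx (dom_mem_om hq) he
    rw [app_leadThen_odd hq hj hqj, sel_pos (h j hj (hqj ▸ hql))]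

/-- In the first `N` rounds, player II plays `0`. -/
theorem pos_lead_eq_zeros (hσ : IsFun σ fs om) (hN : N ∈ (om : M)) (hi : i ∈ N) :
    pos (lead σ N t) (evenIdx i) = pos (leadThen σ N emp emp emp) (evenIdx i) := by
  have hio := mem_om_of_mem hN i hi
  refine pos_congr (isFun_lead hσ N t) (isFun_leadThen hσ N emp emp emp_mem_om)
    (evenIdx_mem_om hio) fun q hq hqi => ?_
  by_cases he : dom q ∈ (evens : M)
  · rw [app_leadThen_even hq he, app_lead_even hq he]
  · obtain ⟨j, hj, hqj⟩ := exists_eq_oddIdx (dom_mem_om hq) he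
    have hjN : j ∈ N := by
      rcases mem_succ.1 (mem_succ_of_oddIdx_mem_evenIdx hj hio (hqj ▸ hqi)) with h | rfl
      · exact mem_trans hN h hi
      · exact hi
    rw [app_lead_odd hq hj hqj, sel_pos hjN, app_leadThen_odd hq hj hqj, sel_neg (not_mem_emp j)]

theorem mem_leadTree : t ∈ leadTree σ ↔ t ∈ (fs : M) ∧ ∀ i ∈ dom t,
    app σ (pos (lead σ (app σ emp) t) (evenIdx i)) = app t i := mem_sep

theorem restr_mem_leadTree (hσ : IsFun σ fs om) (ht : t ∈ leadTree σ) (hn : n ∈ (om : M)) :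
    restr t n ∈ leadTree σ := by
  obtain ⟨htf, hti⟩ := mem_leadTree.1 ht
  have hf := isFun_dom htf
  rcases sub_or_sub hn (dom_mem_om htf) with h | h
  · have hr := hf.restr h
    refine mem_leadTree.2 ⟨mem_fs_of_isFun hn hr, fun i hi => ?_⟩
    rw [dom_eq hn hr] at hi
    have hio := mem_om_of_mem hn i hi
    rw [hf.app_restr h hi, ← hti i (h i hi)]
    congr 1
    refine pos_lead_congr hσ (evenIdx_mem_om hio) fun j hj hji => hf.app_restr h ?_
    rcases mem_succ.1 (mem_succ_of_oddIdx_mem_evenIdx hj hio hji) with h' | rfl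
    · exact mem_trans hn h' hi
    · exact hi
  · rwa [restr_eq_of_sub hf h]

/-- The run of `σ` against a player II who always plays `0`. -/
noncomputable def zeroRun (σ : M) : M := play (leadThen σ (app σ emp) emp emp emp)

theorem isReal_zeroRun (hσ : IsFun σ fs om) : IsReal om (zeroRun σ) :=
  isReal_play (isFun_leadThen hσ _ _ _ emp_mem_om)

theorem emp_mem_fs : (emp : M) ∈ (fs : M) :=
  mem_fs_of_isFun emp_mem_om (isFun_iff.2 (by simp))

/-- During the declared trunk II plays zeros whatever `t` is, so the replies do not depend on `t`.
This forces all nodes of `leadTree` to be comparable with the trunk. -/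
theorem app_pos_lead_of_mem (hσ : IsFun σ fs om) (hi : i ∈ app σ emp) :
    app σ (pos (lead σ (app σ emp) t) (evenIdx i)) = app (decode (zeroRun σ)) i := by
  have hN := hσ.app_mem emp_mem_fs
  have hio := mem_om_of_mem hN i hi
  have hei := evenIdx_mem_om hio
  have hρ := isFun_leadThen hσ (app σ emp) emp emp emp_mem_om
  rw [app_decode hio, zeroRun, app_play hei, pos_lead_eq_zeros hσ hN hi,
    app_leadThen_even (pos_mem_fs hρ hei) (by rw [dom_pos hρ hei]; exact evenIdx_mem_evens hio)]

/-- The trunk of `leadTree`. -/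
noncomputable def leadTrunk (σ : M) : M := restr (decode (zeroRun σ)) (app σ emp)

theorem isFun_leadTrunk (hσ : IsFun σ fs om) : IsFun (leadTrunk σ) (app σ emp) om :=
  IsFun.restr (isReal_decode (isReal_zeroRun hσ)) (sub_om (hσ.app_mem emp_mem_fs))

theorem app_leadTrunk (hσ : IsFun σ fs om) (hi : i ∈ app σ emp) :
    app (leadTrunk σ) i = app (decode (zeroRun σ)) i :=
  IsFun.app_restr (isReal_decode (isReal_zeroRun hσ)) (sub_om (hσ.app_mem emp_mem_fs)) hi

theorem leadTrunk_mem (hσ : IsFun σ fs om) : leadTrunk σ ∈ leadTree σ := by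
  have hN := hσ.app_mem emp_mem_fs
  have hs := isFun_leadTrunk hσ
  refine mem_leadTree.2 ⟨mem_fs_of_isFun hN hs, fun i hi => ?_⟩
  rw [dom_eq hN hs] at hi
  rw [app_pos_lead_of_mem hσ hi, app_leadTrunk hσ hi]

theorem comparable_leadTrunk (hσ : IsFun σ fs om) (ht : t ∈ leadTree σ) :
    Sub t (leadTrunk σ) ∨ Sub (leadTrunk σ) t := by
  obtain ⟨htf, hti⟩ := mem_leadTree.1 ht
  have hf := isFun_dom htf
  have hs := isFun_leadTrunk hσ
  have heq : ∀ i ∈ dom t, i ∈ app σ emp → app t i = app (leadTrunk σ) i := fun i hi hiN => by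
    rw [← hti i hi, app_pos_lead_of_mem hσ hiN, app_leadTrunk hσ hiN]
  rcases sub_or_sub (dom_mem_om htf) (hσ.app_mem emp_mem_fs) with h | h
  · exact Or.inl (hf.sub_of_app_eq hs h fun i hi => heq i hi (h i hi))
  · exact Or.inr (hs.sub_of_app_eq hf h fun i hi => (heq i (h i hi) hi).symm)

variable {A : M}

/-- A run in which player I follows the winning strategy `σ` is in the payoff set. -/
theorem play_mem_payoff {ρ : M} (hσ : IsFun σ fs om)
    (hwin : ∀ x : M, IsReal om x → (∀ n ∈ (om : M), n ∈ (evens : M) → Obeys σ x n) → x ∈ payoff A)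
    (hρ : IsFun ρ fs om)
    (heven : ∀ q ∈ (fs : M), dom q ∈ (evens : M) → app ρ q = app σ q) :
    play ρ ∈ payoff A ∧ app (play ρ) emp = app σ emp := by
  have h : ∀ n ∈ (om : M), n ∈ (evens : M) → app (play ρ) n = app σ (pos ρ n) := fun n hn he => by
    rw [app_play hn, heven _ (pos_mem_fs hρ hn) (by rwa [dom_pos hρ hn])]
  refine ⟨hwin _ (isReal_play hρ) fun n hn he => (obeys_iff hσ (isReal_play hρ) hn).2 ?_, ?_⟩
  · rw [restr_play hρ hn, h n hn he]
  · rw [h _ emp_mem_om emp_mem_evens, pos_emp hρ]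

/-- After leading `σ` through `t`, let II play the bound `m + 1`. The winning `σ` must reply with
some `k > m`, so `k` is an attainable reply and the least move attaining it puts `t⌢⟨k⟩` into the
tree. -/
theorem exists_snoc_mem_leadTree (hσ : IsFun σ fs om)
    (hwin : ∀ x : M, IsReal om x → (∀ n ∈ (om : M), n ∈ (evens : M) → Obeys σ x n) → x ∈ payoff A)
    (ht : t ∈ leadTree σ) (hst : Sub (leadTrunk σ) t) {m : M} (hm : m ∈ (om : M)) :
    ∃ k ∈ (om : M), m ∈ k ∧ ∃ u ∈ leadTree σ, IsSnoc om u t k := by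
  obtain ⟨htf, hti⟩ := mem_leadTree.1 ht
  have hf := isFun_dom htf
  have hn := dom_mem_om htf
  have hodd := oddIdx_mem_om hn
  have heven := evenIdx_mem_om hn
  set N := app σ emp
  set n := dom t
  -- The trunk has length `N` and is contained in `t`, so round `n` lies past the trunk, where the
  -- bounds count.
  have hnN : n ∉ N := fun h => not_mem_self n
    (hf.opair_mem_iff.1 (hst _ ((isFun_leadTrunk hσ).opair_app_mem h))).1
  have hc := succ_mem_om hm
  set ρ := leadThen σ N t n (succ m)
  have hρ : IsFun ρ fs om := isFun_leadThen hσ N t n hc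
  obtain ⟨hz, hz0⟩ := play_mem_payoff hσ hwin hρ fun q => app_leadThen_even
  set q := pos ρ (oddIdx n) with hq
  have hqf : q ∈ (fs : M) := pos_mem_fs hρ hodd
  have hqd : dom q = oddIdx n := dom_pos hρ hodd
  have hρq : app ρ q = succ m := by
    rw [app_leadThen_odd hqf hn hqd, sel_neg (not_mem_self n)]
  have hpe : pos ρ (evenIdx n) = snoc q (succ m) := by
    rw [evenIdx, pos_succ hρ (succ_mem_om (dbl_mem_om hn)), ← hρq]
    rfl
  have hk : app (play ρ) (evenIdx n) = app σ (snoc q (succ m)) := by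
    rw [app_play heven, ← hpe, app_leadThen_even (pos_mem_fs hρ heven)
      (by rw [dom_pos hρ heven]; exact evenIdx_mem_evens hn)]
  set k := app σ (snoc q (succ m)) with hkdef
  have hko : k ∈ (om : M) := hσ.app_mem (snoc_mem_fs hqf hc)
  have hmk : m ∈ k := by
    have := (mem_payoff.1 hz).2.2 n hn (by rwa [hz0])
    rw [hk, app_play hodd, ← hq, hρq] at this
    exact mem_of_not_mem_succ hm hko this
  refine ⟨k, hko, hmk, snoc t k, mem_leadTree.2 ⟨snoc_mem_fs htf hko, fun i hi => ?_⟩,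
    isSnoc_snoc htf⟩
  rw [dom_snoc htf hko] at hi
  rcases mem_succ.1 hi with hi | rfl
  · have hio := mem_om_of_mem hn i hi
    rw [app_snoc htf hko hi, ← hti i hi]
    congr 1
    refine pos_lead_congr hσ (evenIdx_mem_om hio) fun j hj hji => app_snoc htf hko ?_
    rcases mem_succ.1 (mem_succ_of_oddIdx_mem_evenIdx hj hio hji) with h' | rfl
    · exact mem_trans hn h' hi
    · exact hi
  · have hu := isFun_lead hσ N (snoc t k)
    have hpo : pos (lead σ N (snoc t k)) (oddIdx n) = q := by
      rw [hq, pos_leadThen hσ hc hodd fun j hj => oddIdx_mem_oddIdx hj hn]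
      exact pos_lead_congr hσ hodd fun j hj hjn =>
        app_snoc htf hko (oddIdx_mem_oddIdx hj hn hjn)
    have hpe' : pos (lead σ N (snoc t k)) (evenIdx n) =
        snoc q (app (lead σ N (snoc t k)) q) := by
      rw [← hpo, evenIdx, pos_succ hu (succ_mem_om (dbl_mem_om hn))]
      rfl
    rw [hpe', app_lead_odd hqf hn hqd, sel_neg hnN, app_snoc_dom htf hko]
    -- The move `m + 1` witnesses that the reply `k` is attainable; the least such move may be
    -- smaller, but only the reply matters.
    exact app_snoc_leastReply hc hkdef.symm

theorem isLaverTree_leadTree (hσ : IsFun σ fs om)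
    (hwin : ∀ x : M, IsReal om x → (∀ n ∈ (om : M), n ∈ (evens : M) → Obeys σ x n) → x ∈ payoff A) :
    IsLaverTree om (leadTree σ) where
  isFinSeq t ht := mem_fs.1 (mem_leadTree.1 ht).1
  restr_mem t ht n hn s hs := by
    rw [isRestr_iff.1 hs]
    exact restr_mem_leadTree hσ ht hn
  trunk := ⟨leadTrunk σ, leadTrunk_mem hσ, fun _ => comparable_leadTrunk hσ,
    fun _ ht hst _ hm => exists_snoc_mem_leadTree hσ hwin ht hst hm⟩

/-- Leading `σ` along the whole of `f` is a single run. The tree condition at each initial segment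
of `f` says that the values played by `σ` are those of `f`, and `σ` wins. -/
theorem mem_of_isBranch_leadTree (hσ : IsFun σ fs om)
    (hwin : ∀ x : M, IsReal om x → (∀ n ∈ (om : M), n ∈ (evens : M) → Obeys σ x n) → x ∈ payoff A)
    {f : M} (hf : IsBranch om (leadTree σ) f) : f ∈ A := by
  obtain ⟨hfr, hbr⟩ := hf
  have hρ := isFun_lead hσ (app σ emp) f
  have hz := (play_mem_payoff hσ hwin hρ fun q => app_lead_even).1
  have hdec : decode (play (lead σ (app σ emp) f)) = f :=
    IsFun.ext (isReal_decode (isReal_play hρ)) hfr fun i hi => by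
      have hei := evenIdx_mem_om hi
      have hsub : Sub (succ i) om := sub_om (succ_mem_om hi)
      have hr := IsFun.restr hfr hsub
      have ht := (mem_leadTree.1 (hbr (succ i) (succ_mem_om hi) _ (isRestr_iff.2 rfl))).2 i
        (by rw [dom_eq (succ_mem_om hi) hr]; exact mem_succ_self i)
      rw [app_decode hi, app_play hei, app_lead_even (pos_mem_fs hρ hei)
        (by rw [dom_pos hρ hei]; exact evenIdx_mem_evens hi),
        ← IsFun.app_restr hfr hsub (mem_succ_self i), ← ht]
      congr 1
      exact pos_lead_congr hσ hei fun j hj hji => (IsFun.app_restr hfr hsub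
        (mem_succ_of_oddIdx_mem_evenIdx hj hi hji)).symm
  rw [← hdec]
  exact (mem_payoff.1 hz).2.1

end

/-- Determinacy of the Laver game: a win for I yields the tree, and a win for II covers `A` by one
generator, against positivity. -/
theorem exists_laverTree_of_satisfiesAD (hAD : SatisfiesAD M) {A : M}
    (hA : IsSetOfReals om A) (hpos : ¬ InLaverIdeal om A) :
    ∃ T : M, IsLaverTree om T ∧ ∀ f : M, IsBranch om T f → f ∈ A := by
  rcases hAD om evens isOmega_om isEvens_evens (payoff A) fun z hz => (mem_payoff.1 hz).1 with
    ⟨σ, hσ, hwin⟩ | ⟨τ, hτ, hwin⟩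
  · rw [isSeqFun_iff] at hσ
    exact ⟨leadTree σ, isLaverTree_leadTree hσ hwin, fun _ => mem_of_isBranch_leadTree hσ hwin⟩
  · rw [isSeqFun_iff] at hτ
    have hg := isFun_boundFun hτ
    obtain ⟨X, hX, hmem⟩ := exists_isSmallSet hg
    refine absurd (fun J hJ hsmall => ?_) hpos
    exact hJ.subset_mem X (hsmall _ (isSeqFun_iff.2 hg) X hX) A fun f hf =>
      hmem f (hA f hf) fun m hm => exists_bound_of_winning hA hτ hwin hf hm

end Game

end SetModel

theorem lemma3p2p2 :
    -- every Borel positive set contains all branches of a Laver tree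
    (∀ A : Set (ℕ → ℕ), @MeasurableSet (ℕ → ℕ) (borel (ℕ → ℕ)) A → A ∉ Laver.laverIdeal →
      ∃ T : Descriptive.tree ℕ, Laver.IsLaverTree T ∧ Laver.branches T ⊆ A) ∧
    -- every model of ZF + AD satisfies: every positive set contains all branches of a Laver tree
    (∀ (M : Type*) [Membership M M], SetModel.IsModelZF M → SetModel.SatisfiesAD M →
      ∀ w A : M, SetModel.IsOmega w → SetModel.IsSetOfReals w A → ¬ SetModel.InLaverIdeal w A →
        ∃ T : M, SetModel.IsLaverTree w T ∧ ∀ f : M, SetModel.IsBranch w T f → f ∈ A) := by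
  refine ⟨fun A hA hpos => Laver.exists_laverTree_of_borel hA hpos, ?_⟩
  intro M _ hM hAD w A hw hA hpos
  have : SetModel.ModelZF M := ⟨hM⟩
  obtain rfl := hw.eq_om
  exact SetModel.exists_laverTree_of_satisfiesAD hAD hA hpos
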